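/- For a permutation $\pi$ of $[n]$, where $\pi(i)$ is the element in position $i$, let $v_\pi=(\pi^{-1}(1),\dots,\pi^{-1}(n))\in\mathbb{R}^n$ be its position vector, and let $\|\cdot\|$ be the Euclidean norm. Let $d_{\mathrm{KT}}(\pi,\sigma)$ be the number of unordered pairs of elements of $[n]$ that occur in opposite orders in $\pi$ and $\sigma$. For $0\le\phi\le 1$ and a permutation $\pi^*$ of $[n]$, the Mallows model $M(\phi,\pi^*)$ is the probability distribution on the permutations of $[n]$ with $$\Pr[\pi]=\frac{\phi^{d_{\mathrm{KT}}(\pi,\pi^*)}}{\sum_{\tau}\phi^{d_{\mathrm{KT}}(\tau,\pi^*)}}\qquad(0^0=1).$$ Let $D_{\mathrm{TV}}(P,Q)=\frac12\sum_{\pi}|P(\pi)-Q(\pi)|$ denote the total variation distance. **Theorem.** There is a universal constant $C>0$ such that the following holds. For every $n$, every $0\le\phi\le1$ and all permutations $\pi^*,\sigma^*$ of $[n]$ such that $$\|v_{\pi^*}-v_{\sigma^*}\|\le\frac{1}{2(1-\phi)}$$ (for $\phi=1$ the right-hand side is read as $+\infty$, that is, the condition is $2(1-\phi)\|v_{\pi^*}-v_{\sigma^*}\|\le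 1$), we have $$D_{\mathrm{TV}}\big(M(\phi,\pi^*),M(\phi,\sigma^*)\big)\ \ge\ \frac{(1-\phi)\,\|v_{\pi^*}-v_{\sigma^*}\|}{C}.$$ -/

import Mathlib

noncomputable section

namespace Mallows

open Equiv

/-- Rankings of `n` elements are permutations `π`, with `π i` the element in position `i` and
`π.symm x` the position of the element `x`. The Kendall tau distance is the number of relative
inversions: the number of pairs `(x, y)` such that `x` occurs before `y` in `π` and `y` occurs
before `x` in `σ`. (Every inverted unordered pair is counted exactly once.) -/
def kendallTau {n : ℕ} (π σ : Perm (Fin n)) : ℕ :=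
  (Finset.univ.filter fun p : Fin n × Fin n =>
    π.symm p.1 < π.symm p.2 ∧ σ.symm p.2 < σ.symm p.1).card

/-- The normalizing constant `∑ π, φ ^ d(π, πs)`. -/
def partitionFn {n : ℕ} (φ : ℝ) (πs : Perm (Fin n)) : ℝ :=
  ∑ π : Perm (Fin n), φ ^ kendallTau π πs

/-- The probability of `π` under the Mallows model with scaling parameter `φ` and base
permutation `πs`. -/
def mass {n : ℕ} (φ : ℝ) (πs π : Perm (Fin n)) : ℝ :=
  φ ^ kendallTau π πs / partitionFn φ πs

theorem kendallTau_self {n : ℕ} (π : Perm (Fin n)) : kendallTau π π = 0 := by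
  rw [kendallTau, Finset.card_eq_zero, Finset.filter_eq_empty_iff]
  rintro p - ⟨h1, h2⟩
  exact lt_asymm h1 h2

theorem partitionFn_pos {n : ℕ} {φ : ℝ} (hφ : 0 ≤ φ) (πs : Perm (Fin n)) :
    0 < partitionFn φ πs :=
  Finset.sum_pos' (fun _ _ => pow_nonneg hφ _)
    ⟨πs, Finset.mem_univ _, by rw [kendallTau_self, pow_zero]; exact one_pos⟩

theorem mass_nonneg {n : ℕ} {φ : ℝ} (hφ : 0 ≤ φ) (πs π : Perm (Fin n)) : 0 ≤ mass φ πs π :=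
  div_nonneg (pow_nonneg hφ _) (partitionFn_pos hφ πs).le

theorem sum_mass {n : ℕ} {φ : ℝ} (hφ : 0 ≤ φ) (πs : Perm (Fin n)) :
    ∑ π : Perm (Fin n), mass φ πs π = 1 := by
  simp only [mass, ← Finset.sum_div]
  exact div_self (partitionFn_pos hφ πs).ne'

/-- The Mallows model `M(φ, πs)`, as a probability distribution on the permutations. -/
def model {n : ℕ} (φ : ℝ) (hφ : 0 ≤ φ) (πs : Perm (Fin n)) : PMF (Perm (Fin n)) :=
  PMF.ofFintype (fun π => ENNReal.ofReal (mass φ πs π)) (by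
    rw [← ENNReal.ofReal_sum_of_nonneg fun π _ => mass_nonneg hφ πs π, sum_mass hφ,
      ENNReal.ofReal_one])

/-- The position vector `(π⁻¹(1), …, π⁻¹(n))`, in Euclidean space. Positions are numbered from
`1` to `n`. -/
def positionVector {n : ℕ} (π : Perm (Fin n)) : EuclideanSpace ℝ (Fin n) :=
  WithLp.toLp 2 fun x => ((π.symm x : ℕ) : ℝ) + 1

/-- The total variation distance of two distributions on a finite set. -/
def tvDist {α : Type*} [Fintype α] (p q : PMF α) : ℝ :=
  (1 / 2) * ∑ a, |(p a).toReal - (q a).toReal|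

end Mallows

end

/-! Let `α`, `β` be the inverses of the two base permutations: `α * π` sends a position to the base
rank of the element placed there, and the weight of `π` is `φ ^ invCount (α * π)`. The normalizing
constants agree, so the total variation distance is the L¹ distance of the weights over twice that
constant. Let D be the distance of the position vectors.

Cut the positions into blocks of length 2h, with h about 9/(1-φ), and each block into two halves.
Forgetting the order inside the half blocks can only decrease the distance
(`sum_abs_pow_crossCount_sub_le`) and leaves the weight `φ ^ crossCount`. Match left with right
positions; when the elements of some matched pairs are exchanged, this weight behaves like a product
of independent coins (`pow_crossCount_mul_flip`). Passing from `α` to `β` moves each coin by the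
order of (1-φ) times the difference of the local rank changes of the two mates. Products of coins
are at distance at least of the order of the Euclidean distance of their parameters
(`sqrt_le_sum_abs_coinMass_sub`). Local rank changes sum to zero in each block and the matching is
nearly random, so on average this distance has the order of (1-φ) times the norm of the local rank
changes (`sum_mul_localNorm_le`).

It remains to bound the average local norm below by the order of D. D² is half a sum of nonnegative
terms over pairs whose order changes (`sum_shift_sq`); restricted to pairs in a common block, half
this sum is the inner product of the global and local displacements, hence at most D times the local
norm (`sum_sameBlock_le`). A pair whose order changes has base ranks within 2D ≤ 1/(1-φ), so it
lands within h positions with probability at least 1/2 (`partitionFn_le_two_mul_sum_close`), and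
then shares a block in one of two grids offset by h (`sameBlock_of_close`). -/

namespace Mallows

open Finset Equiv

/-! ### Products of independent coins -/

/-- The probability that the set of successes of independent coins `i ∈ s` with success
probabilities `p i` is `t`. -/
def coinMass {ι : Type*} [DecidableEq ι] (p : ι → ℝ) (s t : Finset ι) : ℝ :=
  (∏ i ∈ t, p i) * ∏ i ∈ s \ t, (1 - p i)

/-- A centered linear combination of the coins. -/
def coinDev {ι : Type*} [DecidableEq ι] (p α : ι → ℝ) (s t : Finset ι) : ℝ :=
  ∑ i ∈ s, α i * ((if i ∈ t then 1 else 0) - p i)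

section Coins

variable {ι : Type*} [DecidableEq ι] {p q α : ι → ℝ} {s : Finset ι} {k : ι}

theorem sum_coinMass_insert (hk : k ∉ s) (F : Finset ι → ℝ) :
    ∑ t ∈ (insert k s).powerset, coinMass p (insert k s) t * F t =
      ∑ t ∈ s.powerset,
        coinMass p s t * ((1 - p k) * F t + p k * F (insert k t)) := by
  rw [sum_powerset_insert hk, ← sum_add_distrib]
  refine sum_congr rfl fun t ht => ?_
  have hkt : k ∉ t := fun h => hk (mem_powerset.1 ht h)
  have h1 : coinMass p (insert k s) t = (1 - p k) * coinMass p s t := by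
    unfold coinMass
    rw [insert_sdiff_of_notMem _ hkt, prod_insert (by simp [hk])]
    ring
  have h2 : coinMass p (insert k s) (insert k t) = p k * coinMass p s t := by
    unfold coinMass
    rw [prod_insert hkt, insert_sdiff_insert, sdiff_insert_of_notMem hk]
    ring
  rw [h1, h2]
  ring

theorem coinDev_insert_of_notMem (hk : k ∉ s) {t : Finset ι} (ht : t ⊆ s) :
    coinDev p α (insert k s) t = coinDev p α s t - α k * p k := by
  have hkt : k ∉ t := fun h => hk (ht h)
  unfold coinDev
  rw [sum_insert hk, if_neg hkt]
  ring

theorem coinDev_insert_insert (hk : k ∉ s) (t : Finset ι) :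
    coinDev p α (insert k s) (insert k t) = coinDev p α s t + α k * (1 - p k) := by
  unfold coinDev
  rw [sum_insert hk, if_pos (mem_insert_self k t)]
  have : ∀ i ∈ s, α i * ((if i ∈ insert k t then 1 else 0) - p i) =
      α i * ((if i ∈ t then 1 else 0) - p i) := fun i hi => by
    have : i ≠ k := fun h => hk (h ▸ hi)
    simp [this]
  rw [sum_congr rfl this]
  ring

theorem sum_coinMass (p : ι → ℝ) (s : Finset ι) : ∑ t ∈ s.powerset, coinMass p s t = 1 := by
  have := prod_add p (fun i => 1 - p i) s
  simp only [coinMass, ← this]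
  simp

theorem coinMass_nonneg (h0 : ∀ i ∈ s, 0 ≤ p i) (h1 : ∀ i ∈ s, p i ≤ 1) {t : Finset ι}
    (ht : t ⊆ s) : 0 ≤ coinMass p s t :=
  mul_nonneg (prod_nonneg fun i hi => h0 i (ht hi))
    (prod_nonneg fun i hi => sub_nonneg.2 (h1 i (mem_sdiff.1 hi).1))

theorem coinMass_pos (h0 : ∀ i ∈ s, 0 < p i) (h1 : ∀ i ∈ s, p i < 1) {t : Finset ι}
    (ht : t ⊆ s) : 0 < coinMass p s t :=
  mul_pos (prod_pos fun i hi => h0 i (ht hi))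
    (prod_pos fun i hi => sub_pos.2 (h1 i (mem_sdiff.1 hi).1))

theorem sum_coinMass_mul_coinDev (p α : ι → ℝ) (s : Finset ι) :
    ∑ t ∈ s.powerset, coinMass p s t * coinDev p α s t = 0 := by
  induction s using Finset.induction_on with
  | empty => simp [coinDev]
  | insert k s hk ih =>
    rw [sum_coinMass_insert hk, ← ih]
    refine sum_congr rfl fun t ht => ?_
    rw [coinDev_insert_of_notMem hk (mem_powerset.1 ht), coinDev_insert_insert hk]
    ring

theorem sum_coinMass_mul_coinDev_sq (p α : ι → ℝ) (s : Finset ι) :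
    ∑ t ∈ s.powerset, coinMass p s t * coinDev p α s t ^ 2 =
      ∑ i ∈ s, α i ^ 2 * (p i * (1 - p i)) := by
  induction s using Finset.induction_on with
  | empty => simp [coinDev]
  | insert k s hk ih =>
    rw [sum_coinMass_insert hk, sum_insert hk, ← ih]
    trans ∑ t ∈ s.powerset, (coinMass p s t * (α k ^ 2 * (p k * (1 - p k))) +
      coinMass p s t * coinDev p α s t ^ 2)
    · refine sum_congr rfl fun t ht => ?_
      rw [coinDev_insert_of_notMem hk (mem_powerset.1 ht), coinDev_insert_insert hk]
      ring
    · rw [sum_add_distrib, ← sum_mul, sum_coinMass, one_mul]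

/-- Adding a coin of variance v adds 6α²v times the old second moment and α⁴v(1-3v) to the fourth
moment; the cubic term vanishes since the mean is zero. -/
theorem sum_coinMass_mul_coinDev_pow_four_le (h0 : ∀ i ∈ s, 0 ≤ p i) (h1 : ∀ i ∈ s, p i ≤ 1) :
    ∑ t ∈ s.powerset, coinMass p s t * coinDev p α s t ^ 4 ≤ (∑ i ∈ s, α i ^ 2) ^ 2 := by
  induction s using Finset.induction_on with
  | empty => simp [coinDev]
  | insert k s hk ih =>
    have ih := ih (fun i hi => h0 i (mem_insert_of_mem hi)) fun i hi => h1 i (mem_insert_of_mem hi)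
    have hp0 := h0 k (mem_insert_self k s)
    have hp1 := h1 k (mem_insert_self k s)
    have hv : p k * (1 - p k) ≤ 1 / 4 := by nlinarith [sq_nonneg (p k - 1 / 2)]
    have hv0 : 0 ≤ p k * (1 - p k) := mul_nonneg hp0 (by linarith)
    have h2 : ∑ t ∈ s.powerset, coinMass p s t * coinDev p α s t ^ 2 ≤ ∑ i ∈ s, α i ^ 2 := by
      rw [sum_coinMass_mul_coinDev_sq]
      refine sum_le_sum fun i hi => ?_
      have a0 := h0 i (mem_insert_of_mem hi)
      have a1 := h1 i (mem_insert_of_mem hi)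
      exact mul_le_of_le_one_right (sq_nonneg _) (by nlinarith)
    have h20 : 0 ≤ ∑ t ∈ s.powerset, coinMass p s t * coinDev p α s t ^ 2 :=
      sum_nonneg fun t ht => mul_nonneg (coinMass_nonneg
        (fun i hi => h0 i (mem_insert_of_mem hi)) (fun i hi => h1 i (mem_insert_of_mem hi))
        (mem_powerset.1 ht)) (sq_nonneg _)
    have key : ∑ t ∈ (insert k s).powerset,
        coinMass p (insert k s) t * coinDev p α (insert k s) t ^ 4 =
        (∑ t ∈ s.powerset, coinMass p s t * coinDev p α s t ^ 4) +
        6 * α k ^ 2 * (p k * (1 - p k)) * (∑ t ∈ s.powerset, coinMass p s t * coinDev p α s t ^ 2) +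
        4 * α k ^ 3 * (p k * (1 - p k) * (1 - 2 * p k)) *
          (∑ t ∈ s.powerset, coinMass p s t * coinDev p α s t) +
        α k ^ 4 * (p k * (1 - p k) * (1 - 3 * (p k * (1 - p k)))) *
          (∑ t ∈ s.powerset, coinMass p s t) := by
      rw [sum_coinMass_insert hk]
      simp only [mul_sum, ← sum_add_distrib]
      refine sum_congr rfl fun t ht => ?_
      rw [coinDev_insert_of_notMem hk (mem_powerset.1 ht), coinDev_insert_insert hk]
      ring
    rw [key, sum_coinMass_mul_coinDev, sum_coinMass, sum_insert hk]
    set A := ∑ t ∈ s.powerset, coinMass p s t * coinDev p α s t ^ 2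
    set v := p k * (1 - p k)
    set V := ∑ i ∈ s, α i ^ 2
    have e1 : 6 * α k ^ 2 * v * A ≤ 2 * α k ^ 2 * V := by
      have : 6 * v * A ≤ 2 * V := by nlinarith
      nlinarith [mul_le_mul_of_nonneg_left this (sq_nonneg (α k))]
    have e2 : α k ^ 4 * (v * (1 - 3 * v)) ≤ α k ^ 4 :=
      mul_le_of_le_one_right (by positivity) (by nlinarith)
    nlinarith

/-- One plus the χ² divergence is multiplicative over the coins, with factors 1 + (q-p)²/(p(1-p)).
-/
theorem sum_coinMass_sub_sq_div_le {v : ℝ} (hv : 0 < v) (h0 : ∀ i ∈ s, 0 < p i)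
    (h1 : ∀ i ∈ s, p i < 1) (hpv : ∀ i ∈ s, v ≤ p i * (1 - p i)) :
    ∑ t ∈ s.powerset, (coinMass q s t - coinMass p s t) ^ 2 / coinMass p s t ≤
      Real.exp ((∑ i ∈ s, (q i - p i) ^ 2) / v) - 1 := by
  have e1 : ∑ t ∈ s.powerset, (coinMass q s t - coinMass p s t) ^ 2 / coinMass p s t =
      ∑ t ∈ s.powerset, (coinMass q s t ^ 2 / coinMass p s t) - 1 := by
    have : ∀ t ∈ s.powerset, (coinMass q s t - coinMass p s t) ^ 2 / coinMass p s t =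
        coinMass q s t ^ 2 / coinMass p s t - 2 * coinMass q s t + coinMass p s t := by
      intro t ht
      have := coinMass_pos h0 h1 (mem_powerset.1 ht)
      field_simp
      ring
    rw [sum_congr rfl this, sum_add_distrib, sum_sub_distrib, ← mul_sum, sum_coinMass,
      sum_coinMass]
    ring
  have e2 : ∑ t ∈ s.powerset, (coinMass q s t ^ 2 / coinMass p s t) =
      ∏ i ∈ s, (q i ^ 2 / p i + (1 - q i) ^ 2 / (1 - p i)) := by
    rw [prod_add]
    refine sum_congr rfl fun t _ => ?_
    simp only [coinMass, mul_pow, prod_div_distrib, prod_pow, mul_div_mul_comm]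
  rw [e1, e2, sum_div, Real.exp_sum]
  refine sub_le_sub_right (prod_le_prod (fun i hi => ?_) fun i hi => ?_) 1
  · have := h0 i hi
    have := sub_pos.2 (h1 i hi)
    positivity
  · have a := h0 i hi
    have b := sub_pos.2 (h1 i hi)
    have : q i ^ 2 / p i + (1 - q i) ^ 2 / (1 - p i) =
        (q i - p i) ^ 2 / (p i * (1 - p i)) + 1 := by
      field_simp
      ring
    rw [this]
    refine le_trans ?_ (Real.add_one_le_exp _)
    gcongr
    exact hpv i hi

/-- Two products of coins with bounded odds are at total variation distance at least of the order
of the Euclidean distance of their parameters. -/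
theorem sqrt_le_sum_abs_coinMass_sub {v B : ℝ} (hv : 0 < v) (h0 : ∀ i ∈ s, 0 < p i)
    (h1 : ∀ i ∈ s, p i < 1) (hpv : ∀ i ∈ s, v ≤ p i * (1 - p i))
    (hB : ∑ i ∈ s, (q i - p i) ^ 2 ≤ B) :
    √(∑ i ∈ s, (q i - p i) ^ 2) / (2 * (Real.exp (B / v) / v + 1)) ≤
      ∑ t ∈ s.powerset, |coinMass p s t - coinMass q s t| := by
  set V := ∑ i ∈ s, (q i - p i) ^ 2 with hV
  set C := Real.exp (B / v) / v with hC
  have hC0 : 0 < C := by positivity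
  have hV0 : 0 ≤ V := sum_nonneg fun i _ => sq_nonneg _
  rcases hV0.eq_or_lt with h | hVpos
  · rw [← h]
    simp only [Real.sqrt_zero, zero_div]
    exact sum_nonneg fun _ _ => abs_nonneg _
  set w := √V with hw
  have hwpos : 0 < w := Real.sqrt_pos.2 hVpos
  have hww : w * w = V := Real.mul_self_sqrt hV0
  have hchi : ∑ t ∈ s.powerset, (coinMass q s t - coinMass p s t) ^ 2 / coinMass p s t ≤ C * V := by
    refine (sum_coinMass_sub_sq_div_le hv h0 h1 hpv).trans ?_
    have h3 : Real.exp (V / v) - 1 ≤ V / v * Real.exp (V / v) := by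
      have := Real.add_one_le_exp (-(V / v))
      have h4 : Real.exp (-(V / v)) * Real.exp (V / v) = 1 := by rw [← Real.exp_add]; simp
      nlinarith [Real.exp_pos (V / v)]
    refine h3.trans ?_
    have : Real.exp (V / v) ≤ Real.exp (B / v) := by gcongr
    calc V / v * Real.exp (V / v) ≤ V / v * Real.exp (B / v) := by gcongr
      _ = C * V := by rw [hC]; ring
  have h4 := sum_coinMass_mul_coinDev_pow_four_le (p := p) (α := fun i => q i - p i) (s := s)
    (fun i hi => (h0 i hi).le) fun i hi => (h1 i hi).le
  rw [← hV] at h4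
  -- Test statistic: a linear form with coefficients `q - p`, whose means under the two products
  -- differ by exactly `V`.
  set S := fun t => coinDev p (fun i => q i - p i) s t with hS
  have hmean : ∑ t ∈ s.powerset, (coinMass q s t - coinMass p s t) * S t = V := by
    have e : ∀ t, S t = coinDev q (fun i => q i - p i) s t + V := by
      intro t
      simp only [hS, coinDev, hV, ← sum_add_distrib]
      exact sum_congr rfl fun i _ => by ring
    have e1 : ∑ t ∈ s.powerset, coinMass q s t * S t = V := by
      simp only [e, mul_add, sum_add_distrib]
      rw [sum_coinMass_mul_coinDev, ← sum_mul, sum_coinMass]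
      ring
    simp only [sub_mul, sum_sub_distrib, e1]
    rw [sum_coinMass_mul_coinDev]
    ring
  -- Truncation level for `S`. The tail `S² / M` is controlled by the χ² divergence and the fourth
  -- moment; this `M` makes its contribution exactly `V / 2`.
  set M := (C + 1) * w with hM
  have hMpos : 0 < M := by positivity
  have hle : V ≤ ∑ t ∈ s.powerset, (M * |coinMass p s t - coinMass q s t| +
      1 / (2 * M) * (w * ((coinMass q s t - coinMass p s t) ^ 2 / coinMass p s t) +
        coinMass p s t * S t ^ 4 / w)) := by
    rw [← hmean]
    refine sum_le_sum fun t ht => ?_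
    have hP := coinMass_pos h0 h1 (mem_powerset.1 ht)
    set P := coinMass p s t
    set Q := coinMass q s t
    have a1 : (Q - P) * S t ≤ |P - Q| * |S t| := by
      rw [abs_sub_comm, ← abs_mul]; exact le_abs_self _
    have a2 : |S t| ≤ M + S t ^ 2 / M := by
      rw [← sq_abs (S t), ← sub_nonneg]
      have : M + |S t| ^ 2 / M - |S t| = ((|S t| - M / 2) ^ 2 + 3 / 4 * M ^ 2) / M := by
        field_simp; ring
      rw [this]; positivity
    have a3 : |P - Q| * S t ^ 2 ≤ 1 / 2 * (w * ((Q - P) ^ 2 / P) + P * S t ^ 4 / w) := by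
      rw [← sub_nonneg]
      have : 1 / 2 * (w * ((Q - P) ^ 2 / P) + P * S t ^ 4 / w) - |P - Q| * S t ^ 2 =
          1 / 2 * (w * |P - Q| - P * S t ^ 2) ^ 2 / (w * P) := by
        have : (Q - P) ^ 2 = |P - Q| ^ 2 := by rw [sq_abs]; ring
        rw [this]
        field_simp
        ring
      rw [this]; positivity
    calc (Q - P) * S t ≤ |P - Q| * |S t| := a1
      _ ≤ |P - Q| * (M + S t ^ 2 / M) := by gcongr
      _ = M * |P - Q| + 1 / M * (|P - Q| * S t ^ 2) := by ring
      _ ≤ M * |P - Q| + 1 / M * (1 / 2 * (w * ((Q - P) ^ 2 / P) + P * S t ^ 4 / w)) := by gcongr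
      _ = _ := by ring_nf
  rw [sum_add_distrib, ← mul_sum, ← mul_sum, sum_add_distrib, ← mul_sum, ← sum_div] at hle
  set T := ∑ t ∈ s.powerset, |coinMass p s t - coinMass q s t|
  have b1 : 1 / (2 * M) * (w * ∑ t ∈ s.powerset, (coinMass q s t - coinMass p s t) ^ 2 /
      coinMass p s t + (∑ t ∈ s.powerset, coinMass p s t * S t ^ 4) / w) ≤
      1 / (2 * M) * (w * (C * V) + V ^ 2 / w) := by gcongr
  have b2 : 1 / (2 * M) * (w * (C * V) + V ^ 2 / w) = V / 2 := by
    rw [hM, ← hww]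
    field_simp
  rw [div_le_iff₀ (by positivity)]
  have : V / 2 ≤ M * T := by linarith
  rw [hM, ← hww] at this
  nlinarith

end Coins

/-! ### Inversions and averaging over classes of positions -/

variable {n : ℕ}

theorem card_filter_pairs_comp (g : Perm (Fin n)) (P : Fin n → Fin n → Prop)
    [DecidableRel P] :
    #{x : Fin n × Fin n | P (g x.1) (g x.2)} = #{x : Fin n × Fin n | P x.1 x.2} :=
  card_equiv (g.prodCongr g) fun x => by simp

theorem card_filter_comp (g : Perm (Fin n)) (P : Fin n → Prop) [DecidablePred P] :
    #{x : Fin n | P (g x)} = #{x : Fin n | P x} :=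
  card_equiv g fun x => by simp

/-- The number of inversions of a permutation. -/
def invCount (ω : Perm (Fin n)) : ℕ :=
  #{x : Fin n × Fin n | x.1 < x.2 ∧ ω x.2 < ω x.1}

theorem kendallTau_eq_invCount (π τ : Perm (Fin n)) :
    kendallTau π τ = invCount (τ⁻¹ * π) := by
  rw [invCount, kendallTau,
    ← card_filter_pairs_comp π fun x y => π.symm x < π.symm y ∧ τ.symm y < τ.symm x]
  simp only [symm_apply_apply]
  rfl

/-- The number of inversions between positions of different classes of `H`. -/
def crossCount (H : Fin n → ℕ) (ω : Perm (Fin n)) : ℕ :=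
  #{x : Fin n × Fin n | H x.1 < H x.2 ∧ ω x.2 < ω x.1}

/-- The number of inversions within the classes of `H`. -/
def innerCount (H : Fin n → ℕ) (ω : Perm (Fin n)) : ℕ :=
  #{x : Fin n × Fin n | (x.1 < x.2 ∧ H x.1 = H x.2) ∧ ω x.2 < ω x.1}

/-- The permutations that preserve the classes of `H`. -/
def classPerms (H : Fin n → ℕ) : Finset (Perm (Fin n)) := {g | ∀ p, H (g p) = H p}

theorem mem_classPerms {H : Fin n → ℕ} {g : Perm (Fin n)} :
    g ∈ classPerms H ↔ ∀ p, H (g p) = H p := by simp [classPerms]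

theorem one_mem_classPerms (H : Fin n → ℕ) : 1 ∈ classPerms H := by simp [classPerms]

theorem crossCount_mul {H : Fin n → ℕ} {g : Perm (Fin n)} (hg : ∀ p, H (g p) = H p)
    (ω : Perm (Fin n)) : crossCount H (ω * g) = crossCount H ω := by
  rw [crossCount, crossCount,
    ← card_filter_pairs_comp g fun x y => H x < H y ∧ ω y < ω x]
  simp only [hg]
  rfl

theorem crossCount_add_innerCount {H : Fin n → ℕ} (hH : Monotone H) (ω : Perm (Fin n)) :
    crossCount H ω + innerCount H ω = invCount ω := by
  rw [crossCount, innerCount, invCount, ← card_union_of_disjoint]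
  · congr 1
    ext x
    simp only [mem_union, mem_filter, mem_univ, true_and]
    constructor
    · rintro (⟨h1, h2⟩ | ⟨h1, h2⟩)
      · exact ⟨hH.reflect_lt h1, h2⟩
      · exact ⟨h1.1, h2⟩
    · rintro ⟨h1, h2⟩
      rcases (hH h1.le).lt_or_eq with h | h
      · exact Or.inl ⟨h, h2⟩
      · exact Or.inr ⟨⟨h1, h⟩, h2⟩
  · rw [disjoint_filter]
    rintro x - ⟨h1, -⟩ ⟨⟨-, h2⟩, -⟩
    exact h1.ne h2

theorem exists_sorting_classPerm {H : Fin n → ℕ} (hH : Monotone H) (ω : Perm (Fin n)) :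
    ∃ g ∈ classPerms H, ∀ p q, H p = H q → p < q → ω (g p) < ω (g q) := by
  set key : Fin n → ℕ ×ₗ Fin n := fun p => toLex (H p, ω p) with hkey
  set g := Tuple.sort key with hg
  have hmono : Monotone (key ∘ g) := Tuple.monotone_sort key
  have hHg : Monotone (H ∘ g) := fun p q hpq => by
    have := hmono hpq
    simp only [hkey, Function.comp, Prod.Lex.toLex_le_toLex] at this
    rcases this with h | h
    · exact h.le
    · exact h.1.le
  have heq : H ∘ g = H := by
    -- Sorting by `key` makes `H ∘ g` monotone, and `H` has only one monotone rearrangement: itself.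
    have := Tuple.unique_monotone (f := H) (σ := g) (τ := 1) hHg (by simpa using hH)
    simpa using this
  refine ⟨g, mem_classPerms.2 fun p => congrFun heq p, fun p q hpq hlt => ?_⟩
  have := hmono hlt.le
  simp only [hkey, Function.comp, Prod.Lex.toLex_le_toLex] at this
  have e : H (g p) = H (g q) := by
    rw [show H (g p) = H p from congrFun heq p, show H (g q) = H q from congrFun heq q, hpq]
  rcases this with h | h
  · exact absurd e h.ne
  · exact lt_of_le_of_ne h.2 fun h' => hlt.ne (by simpa using h')

/-- Averaging the weight over the arrangements within the classes of `H` leaves the inversions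
between different classes. -/
theorem sum_classPerms_pow_invCount {H : Fin n → ℕ} (hH : Monotone H) (φ : ℝ)
    (ω : Perm (Fin n)) :
    ∑ g ∈ classPerms H, φ ^ invCount (ω * g) =
      (∑ g ∈ classPerms H, φ ^ innerCount H g) * φ ^ crossCount H ω := by
  obtain ⟨g₀, hg₀, hsort⟩ := exists_sorting_classPerm hH ω
  rw [mem_classPerms] at hg₀
  have hstrict : ∀ p q, H p = H q → (ω (g₀ p) < ω (g₀ q) ↔ p < q) := by
    intro p q hpq
    refine ⟨fun h => ?_, hsort p q hpq⟩
    by_contra hlt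
    rcases (not_lt.1 hlt).lt_or_eq with h' | h'
    · exact lt_asymm h (hsort q p hpq.symm h')
    · exact h.ne (by rw [h'])
  rw [sum_mul]
  -- Reparametrize the coset by its representative `ω * g₀`, sorted within classes, so that the
  -- inner inversions are those of `g` alone.
  refine (sum_bij' (fun g _ => g₀ * g) (fun g _ => g₀⁻¹ * g) ?_ ?_ ?_ ?_ ?_).symm
  · intro g hg
    rw [mem_classPerms] at hg ⊢
    intro p
    rw [Perm.mul_apply, hg₀, hg]
  · intro g hg
    rw [mem_classPerms] at hg ⊢
    intro p
    rw [← hg₀, ← Perm.mul_apply, mul_inv_cancel_left, hg]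
  · intro g _; simp
  · intro g _; simp
  · intro g hg
    rw [mem_classPerms] at hg
    have hgg : ∀ p, H ((g₀ * g) p) = H p := fun p => by rw [Perm.mul_apply, hg₀, hg]
    rw [← crossCount_add_innerCount hH, crossCount_mul hgg, pow_add, mul_comm]
    congr 2
    unfold innerCount
    congr 1
    refine filter_congr fun x _ => and_congr_right fun h => ?_
    have : H (g x.2) = H (g x.1) := by rw [hg, hg, h.2]
    exact (hstrict _ _ this).symm

/-! ### Half blocks and flips -/

/-- A decomposition of the positions into blocks, each cut into a left and a right half whose
elements are matched with each other, with at most one element left over. -/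
structure HalfBlocks (n : ℕ) where
  block : Fin n → ℕ
  left : Finset (Fin n)
  mate : Fin n → Fin n
  mate_mate : ∀ p, mate (mate p) = p
  block_mate : ∀ p, block (mate p) = block p
  mate_notMem : ∀ p ∈ left, mate p ∉ left
  mate_mem : ∀ p ∉ left, mate p = p ∨ mate p ∈ left
  eq_of_mate_eq : ∀ p q, mate p = p → mate q = q → block p = block q → p = q
  half_monotone : Monotone fun p => 2 * block p + if p ∈ left then 0 else 1

namespace HalfBlocks

variable (B : HalfBlocks n)

/-- The index of the half block of a position. -/
def half (p : Fin n) : ℕ := 2 * B.block p + if p ∈ B.left then 0 else 1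

theorem block_eq_of_half_eq {p q : Fin n} (h : B.half p = B.half q) : B.block p = B.block q := by
  unfold half at h
  split_ifs at h <;> omega

theorem half_lt_iff (p q : Fin n) : B.half p < B.half q ↔
    B.block p < B.block q ∨ B.block p = B.block q ∧ p ∈ B.left ∧ q ∉ B.left := by
  unfold half
  by_cases hp : p ∈ B.left <;> by_cases hq : q ∈ B.left <;> simp only [hp, hq, if_true, if_false,
    not_true, not_false_iff, and_true, and_false, or_false] <;> omega

/-- The rank of the element in position `p` among the elements of its block. -/
def localRank (ω : Perm (Fin n)) (p : Fin n) : ℕ :=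
  #{q : Fin n | B.block q = B.block p ∧ ω q < ω p}

theorem localRank_mul {g : Perm (Fin n)} (hg : ∀ p, B.block (g p) = B.block p)
    (ω : Perm (Fin n)) (p : Fin n) : B.localRank (ω * g) p = B.localRank ω (g p) := by
  unfold localRank
  rw [← card_filter_comp g fun q => B.block q = B.block (g p) ∧ ω q < ω (g p)]
  simp only [hg]
  rfl

/-- The number of pairs of left positions of the same block. -/
def leftPairs : ℕ :=
  #{x : Fin n × Fin n | x.1 < x.2 ∧ x.1 ∈ B.left ∧ x.2 ∈ B.left ∧ B.block x.2 = B.block x.1}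

/-- Exactly one orientation of each pair is inverted, so the count does not depend on `ω`. -/
theorem leftPairs_eq (ω : Perm (Fin n)) : B.leftPairs =
    #{x : Fin n × Fin n | x.1 ∈ B.left ∧ x.2 ∈ B.left ∧ B.block x.2 = B.block x.1 ∧
      ω x.2 < ω x.1} := by
  refine card_bij' (fun x _ => if ω x.2 < ω x.1 then x else (x.2, x.1))
    (fun x _ => if x.1 < x.2 then x else (x.2, x.1)) ?_ ?_ ?_ ?_
  · rintro ⟨p, q⟩ h
    simp only [mem_filter, mem_univ, true_and] at h ⊢
    split_ifs with h1
    · exact ⟨h.2.1, h.2.2.1, h.2.2.2, h1⟩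
    · exact ⟨h.2.2.1, h.2.1, h.2.2.2.symm, lt_of_le_of_ne (not_lt.1 h1)
        fun h' => h.1.ne (ω.injective h')⟩
  · rintro ⟨p, q⟩ h
    simp only [mem_filter, mem_univ, true_and] at h ⊢
    split_ifs with h1
    · exact ⟨h1, h.1, h.2.1, h.2.2.1⟩
    · exact ⟨lt_of_le_of_ne (not_lt.1 h1) fun h' => h.2.2.2.ne (congrArg ω h'), h.2.1, h.1,
        h.2.2.1.symm⟩
  · rintro ⟨p, q⟩ h
    simp only [mem_filter, mem_univ, true_and] at h ⊢
    split_ifs with h1 h2 h2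
    · rfl
    · exact absurd h.1 h2
    · exact absurd h.1 (lt_asymm h2)
    · rfl
  · rintro ⟨p, q⟩ h
    simp only [mem_filter, mem_univ, true_and] at h ⊢
    split_ifs with h1 h2 h2
    · rfl
    · exact absurd h.2.2.2 h2
    · exact absurd h.2.2.2 (lt_asymm h2)
    · rfl

/-- The local ranks of the left positions count the left-right inversions of each block and, once
each, the left-left pairs. The half-block inversions thus become a sum over single positions, which
is what makes the flips independent. -/
theorem crossCount_half_add (ω : Perm (Fin n)) :
    crossCount B.half ω + B.leftPairs =
      crossCount B.block ω + ∑ p ∈ B.left, B.localRank ω p := by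
  have e1 : crossCount B.half ω = crossCount B.block ω +
      #{x : Fin n × Fin n | x.1 ∈ B.left ∧ x.2 ∉ B.left ∧ B.block x.2 = B.block x.1 ∧
        ω x.2 < ω x.1} := by
    rw [crossCount, crossCount, ← card_union_of_disjoint]
    · congr 1
      ext x
      simp only [mem_union, mem_filter, mem_univ, true_and, half_lt_iff]
      constructor
      · rintro ⟨h1 | h1, h2⟩
        · exact Or.inl ⟨h1, h2⟩
        · exact Or.inr ⟨h1.2.1, h1.2.2, h1.1.symm, h2⟩
      · rintro (⟨h1, h2⟩ | ⟨h1, h2, h3, h4⟩)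
        · exact ⟨Or.inl h1, h2⟩
        · exact ⟨Or.inr ⟨h3.symm, h1, h2⟩, h4⟩
    · rw [disjoint_filter]
      rintro x - ⟨h1, -⟩ ⟨-, -, h2, -⟩
      exact h1.ne h2.symm
  have e2 : ∑ p ∈ B.left, B.localRank ω p =
      #{x : Fin n × Fin n | x.1 ∈ B.left ∧ B.block x.2 = B.block x.1 ∧ ω x.2 < ω x.1} := by
    have : ({x : Fin n × Fin n | x.1 ∈ B.left ∧ B.block x.2 = B.block x.1 ∧ ω x.2 < ω x.1} :
        Finset (Fin n × Fin n)).card = ∑ p ∈ B.left, #{x ∈ ({x : Fin n × Fin n | x.1 ∈ B.left ∧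
        B.block x.2 = B.block x.1 ∧ ω x.2 < ω x.1} : Finset (Fin n × Fin n)) | x.1 = p} :=
      card_eq_sum_card_fiberwise (by rintro x hx; simp at hx; exact hx.1)
    rw [this]
    refine sum_congr rfl fun p hp => ?_
    refine card_bij' (fun q _ => (p, q)) (fun x _ => x.2) ?_ ?_ ?_ ?_
    · intro q hq
      simp only [mem_filter, mem_univ, true_and] at hq ⊢
      exact ⟨⟨hp, hq⟩, trivial⟩
    · rintro ⟨p', q⟩ hx
      simp only [mem_filter, mem_univ, true_and] at hx ⊢
      rw [← hx.2]; exact hx.1.2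
    · intro q _; rfl
    · rintro ⟨p', q⟩ hx
      simp only [mem_filter, mem_univ, true_and] at hx ⊢
      rw [hx.2]
  rw [e1, e2, B.leftPairs_eq ω, add_assoc, ← card_union_of_disjoint]
  · congr 2
    ext x
    simp only [mem_union, mem_filter, mem_univ, true_and]
    tauto
  · rw [disjoint_filter]
    rintro x - ⟨-, h1, -⟩ ⟨-, h2, -⟩
    exact h1 h2

theorem mate_injective : Function.Injective B.mate :=
  Function.LeftInverse.injective B.mate_mate

/-- Exchange the elements in positions `p` and `mate p` for `p ∈ t`. -/
def flip (t : Finset (Fin n)) : Perm (Fin n) :=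
  Function.Involutive.toPerm (fun p => if p ∈ t ∨ B.mate p ∈ t then B.mate p else p) (by
    intro p
    by_cases h : p ∈ t ∨ B.mate p ∈ t
    · simp only [h, if_true, B.mate_mate, h.symm]
    · simp only [h, if_false])

theorem flip_apply (t : Finset (Fin n)) (p : Fin n) :
    B.flip t p = if p ∈ t ∨ B.mate p ∈ t then B.mate p else p := rfl

theorem block_flip (t : Finset (Fin n)) (p : Fin n) : B.block (B.flip t p) = B.block p := by
  rw [flip_apply]
  split_ifs
  · exact B.block_mate p
  · rfl

theorem flip_apply_of_mem_left {t : Finset (Fin n)} (ht : t ⊆ B.left) {p : Fin n}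
    (hp : p ∈ B.left) : B.flip t p = if p ∈ t then B.mate p else p := by
  have : B.mate p ∉ t := fun h => B.mate_notMem p hp (ht h)
  rw [flip_apply]
  simp [this]

end HalfBlocks

/-! ### Sensitivity of the coin probabilities to the ranks -/

theorem pow_sub_pow_bounds {φ : ℝ} (h0 : 0 < φ) (h1 : φ ≤ 1) {a b : ℕ} (hab : a ≤ b) :
    φ ^ b * ((1 - φ) * (b - a)) ≤ φ ^ a - φ ^ b ∧ φ ^ a - φ ^ b ≤ (1 - φ) * (b - a) := by
  obtain ⟨m, rfl⟩ := Nat.exists_eq_add_of_le hab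
  have hg := mul_neg_geom_sum φ m
  have e : φ ^ a - φ ^ (a + m) = φ ^ a * ((1 - φ) * ∑ i ∈ range m, φ ^ i) := by
    rw [hg, pow_add]; ring
  have hup : ∑ i ∈ range m, φ ^ i ≤ m := by
    calc ∑ i ∈ range m, φ ^ i ≤ ∑ i ∈ range m, (1 : ℝ) :=
          sum_le_sum fun i _ => pow_le_one₀ h0.le h1
      _ = m := by simp
  have hlow : m * φ ^ m ≤ ∑ i ∈ range m, φ ^ i := by
    calc m * φ ^ m = ∑ i ∈ range m, φ ^ m := by simp
      _ ≤ _ := sum_le_sum fun i hi => pow_le_pow_of_le_one h0.le h1 (mem_range.1 hi).le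
  have he : 0 ≤ 1 - φ := by linarith
  have ha : φ ^ a ≤ 1 := pow_le_one₀ h0.le h1
  have ha0 : 0 < φ ^ a := by positivity
  rw [e]
  push_cast
  constructor
  · calc φ ^ (a + m) * ((1 - φ) * (a + m - a)) = φ ^ a * ((1 - φ) * (m * φ ^ m)) := by
          rw [pow_add]; ring
      _ ≤ _ := by gcongr
  · calc φ ^ a * ((1 - φ) * ∑ i ∈ range m, φ ^ i) ≤ 1 * ((1 - φ) * m) := by gcongr
      _ = _ := by ring

theorem abs_pow_sub_pow_bounds {φ κ : ℝ} (h0 : 0 < φ) (h1 : φ ≤ 1) {a b : ℕ}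
    (ha : κ ≤ φ ^ a) (hb : κ ≤ φ ^ b) :
    κ * ((1 - φ) * |(b : ℝ) - a|) ≤ |φ ^ b - φ ^ a| ∧
      |φ ^ b - φ ^ a| ≤ (1 - φ) * |(b : ℝ) - a| := by
  have he : 0 ≤ 1 - φ := by linarith
  have key : ∀ a b : ℕ, κ ≤ φ ^ b → a ≤ b → κ * ((1 - φ) * |(b : ℝ) - a|) ≤ |φ ^ b - φ ^ a| ∧
      |φ ^ b - φ ^ a| ≤ (1 - φ) * |(b : ℝ) - a| := by
    intro a b hb hab
    have := pow_sub_pow_bounds h0 h1 hab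
    have h2 : φ ^ b ≤ φ ^ a := pow_le_pow_of_le_one h0.le h1 hab
    have h3 : (0 : ℝ) ≤ b - a := sub_nonneg.2 (by exact_mod_cast hab)
    rw [abs_of_nonneg h3, abs_sub_comm, abs_of_nonneg (sub_nonneg.2 h2)]
    exact ⟨le_trans (by gcongr) this.1, this.2⟩
  rcases le_total a b with h | h
  · exact key a b hb h
  · have := key b a ha h
    rwa [abs_sub_comm, abs_sub_comm (φ ^ a)] at this

/-- The success probability of a coin whose odds are `φ ^ i'` to `φ ^ i`. -/
noncomputable def oddsProb (φ : ℝ) (i i' : ℕ) : ℝ := φ ^ i' / (φ ^ i + φ ^ i')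

theorem oddsProb_bounds {φ κ : ℝ} (hκ : 0 < κ) (h0 : 0 < φ) (h1 : φ ≤ 1) {i i' : ℕ}
    (hi : κ ≤ φ ^ i) (hi' : κ ≤ φ ^ i') :
    κ / 2 ≤ oddsProb φ i i' ∧ κ / 2 ≤ 1 - oddsProb φ i i' := by
  have a := pow_le_one₀ h0.le h1 (n := i)
  have b := pow_le_one₀ h0.le h1 (n := i')
  have c : 0 < φ ^ i + φ ^ i' := by positivity
  have : 1 - oddsProb φ i i' = φ ^ i / (φ ^ i + φ ^ i') := by unfold oddsProb; field_simp; ring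
  rw [this, oddsProb]
  constructor <;> rw [div_le_div_iff₀ two_pos c] <;> nlinarith

/-- Over a common denominator the difference has numerator `φ ^ (i + j') - φ ^ (i' + j)`, of the
order of (1-φ) times the difference of exponents while all powers stay above `κ`. -/
theorem abs_oddsProb_sub_bounds {φ κ : ℝ} (hκ : 0 < κ) (h0 : 0 < φ) (h1 : φ ≤ 1) {i i' j j' : ℕ}
    (hi : κ ≤ φ ^ i) (hi' : κ ≤ φ ^ i') (hj : κ ≤ φ ^ j) (hj' : κ ≤ φ ^ j') :
    κ ^ 2 / 4 * ((1 - φ) * |((j' : ℝ) - i') - (j - i)|) ≤ |oddsProb φ j j' - oddsProb φ i i'| ∧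
      |oddsProb φ j j' - oddsProb φ i i'| ≤
        1 / (4 * κ ^ 2) * ((1 - φ) * |((j' : ℝ) - i') - (j - i)|) := by
  have hκ2 : ∀ a b : ℕ, κ ≤ φ ^ a → κ ≤ φ ^ b → κ ^ 2 ≤ φ ^ (a + b) := fun a b ha hb => by
    rw [pow_add, sq]; exact mul_le_mul ha hb hκ.le (hκ.le.trans ha)
  have hb := abs_pow_sub_pow_bounds h0 h1 (hκ2 _ _ hi' hj) (hκ2 _ _ hi hj')
  have hup : ∀ a : ℕ, φ ^ a ≤ 1 := fun a => pow_le_one₀ h0.le h1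
  have hpos : ∀ a : ℕ, 0 < φ ^ a := fun a => by positivity
  have e : oddsProb φ j j' - oddsProb φ i i' =
      (φ ^ (i + j') - φ ^ (i' + j)) / ((φ ^ i + φ ^ i') * (φ ^ j + φ ^ j')) := by
    unfold oddsProb
    have := hpos i; have := hpos i'; have := hpos j; have := hpos j'
    field_simp
    ring
  have hd : 0 < (φ ^ i + φ ^ i') * (φ ^ j + φ ^ j') :=
    mul_pos (add_pos (hpos _) (hpos _)) (add_pos (hpos _) (hpos _))
  have hd1 : (φ ^ i + φ ^ i') * (φ ^ j + φ ^ j') ≤ 4 := by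
    nlinarith [hup i, hup i', hup j, hup j', hpos i, hpos i', hpos j, hpos j']
  have hd2 : 4 * κ ^ 2 ≤ (φ ^ i + φ ^ i') * (φ ^ j + φ ^ j') := by
    have : 2 * κ ≤ φ ^ i + φ ^ i' := by linarith
    have : 2 * κ ≤ φ ^ j + φ ^ j' := by linarith
    nlinarith
  rw [e, abs_div, abs_of_pos hd]
  have e2 : ((i + j' : ℕ) : ℝ) - (i' + j : ℕ) = ((j' : ℝ) - i') - (j - i) := by push_cast; ring
  rw [e2] at hb
  have he : 0 ≤ 1 - φ := by linarith
  set δ := |((j' : ℝ) - i') - (j - i)|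
  have hδ : 0 ≤ (1 - φ) * δ := mul_nonneg he (abs_nonneg _)
  constructor
  · rw [le_div_iff₀ hd]
    calc _ ≤ κ ^ 2 / 4 * ((1 - φ) * δ) * 4 := by gcongr
      _ = κ ^ 2 * ((1 - φ) * δ) := by ring
      _ ≤ _ := hb.1
  · rw [div_le_iff₀ hd]
    calc _ ≤ (1 - φ) * δ := hb.2
      _ = 1 / (4 * κ ^ 2) * ((1 - φ) * δ) * (4 * κ ^ 2) := by field_simp
      _ ≤ _ := by gcongr

/-- An orbit may have different masses under the two models. The mass gap is itself at most the L¹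
distance, so equalizing the masses costs only a factor 2. -/
theorem half_mul_sum_abs_sub_le {ι : Type*} (s : Finset ι) {P Q : ι → ℝ} {w w' : ℝ} (hw : 0 ≤ w)
    (hP : ∑ i ∈ s, P i = 1) (hQ : ∑ i ∈ s, Q i = 1) (hQ0 : ∀ i ∈ s, 0 ≤ Q i) :
    w / 2 * ∑ i ∈ s, |P i - Q i| ≤ ∑ i ∈ s, |w * P i - w' * Q i| := by
  have h1 : |w - w'| ≤ ∑ i ∈ s, |w * P i - w' * Q i| := by
    have : w - w' = ∑ i ∈ s, (w * P i - w' * Q i) := by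
      rw [sum_sub_distrib, ← mul_sum, ← mul_sum, hP, hQ]; ring
    rw [this]; exact abs_sum_le_sum_abs _ _
  have h2 : w * ∑ i ∈ s, |P i - Q i| ≤ ∑ i ∈ s, (|w * P i - w' * Q i| + |w - w'| * Q i) := by
    rw [mul_sum]
    refine sum_le_sum fun i hi => ?_
    have e : w * |P i - Q i| = |(w * P i - w' * Q i) - (w - w') * Q i| := by
      rw [← abs_of_nonneg hw, ← abs_mul, abs_of_nonneg hw]; congr 1; ring
    rw [e]
    refine (abs_sub _ _).trans ?_
    rw [abs_mul, abs_of_nonneg (hQ0 i hi)]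
  rw [sum_add_distrib, ← mul_sum, hQ] at h2
  linarith

/-! ### Distance of the models on the orbits of the flips -/

namespace HalfBlocks

variable (B : HalfBlocks n)

/-- The probability of `flip` exchanging `p` with its mate. -/
noncomputable def flipProb (φ : ℝ) (ω : Perm (Fin n)) (p : Fin n) : ℝ :=
  oddsProb φ (B.localRank ω p) (B.localRank ω (B.mate p))

/-- The total weight of an orbit of the flips. -/
noncomputable def orbitWeight (φ : ℝ) (ω : Perm (Fin n)) : ℝ :=
  φ ^ crossCount B.block ω * (∏ p ∈ B.left,
    (φ ^ B.localRank ω p + φ ^ B.localRank ω (B.mate p))) / φ ^ B.leftPairs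

theorem pow_crossCount_mul_flip {φ : ℝ} (h0 : 0 < φ) (ω : Perm (Fin n)) {t : Finset (Fin n)}
    (ht : t ⊆ B.left) : φ ^ crossCount B.half (ω * B.flip t) =
      B.orbitWeight φ ω * coinMass (B.flipProb φ ω) B.left t := by
  have h := congrArg (φ ^ ·) (B.crossCount_half_add (ω * B.flip t))
  simp only [pow_add] at h
  rw [crossCount_mul (B.block_flip t)] at h
  have e : φ ^ (∑ p ∈ B.left, B.localRank (ω * B.flip t) p) =
      (∏ p ∈ B.left, (φ ^ B.localRank ω p + φ ^ B.localRank ω (B.mate p))) *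
        coinMass (B.flipProb φ ω) B.left t := by
    rw [← prod_pow_eq_pow_sum, coinMass, ← prod_sdiff ht, ← prod_sdiff ht]
    have e1 : ∀ p ∈ B.left \ t, φ ^ B.localRank (ω * B.flip t) p =
        (φ ^ B.localRank ω p + φ ^ B.localRank ω (B.mate p)) * (1 - B.flipProb φ ω p) := by
      intro p hp
      rw [mem_sdiff] at hp
      rw [B.localRank_mul (B.block_flip t), B.flip_apply_of_mem_left ht hp.1, if_neg hp.2,
        flipProb, oddsProb]
      field_simp
      ring
    have e2 : ∀ p ∈ t, φ ^ B.localRank (ω * B.flip t) p =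
        (φ ^ B.localRank ω p + φ ^ B.localRank ω (B.mate p)) * B.flipProb φ ω p := by
      intro p hp
      rw [B.localRank_mul (B.block_flip t), B.flip_apply_of_mem_left ht (ht hp), if_pos hp,
        flipProb, oddsProb]
      field_simp
    rw [prod_congr rfl e1, prod_congr rfl e2, prod_mul_distrib, prod_mul_distrib]
    ring
  rw [e] at h
  have : φ ^ B.leftPairs ≠ 0 := by positivity
  rw [orbitWeight, eq_comm, div_mul_eq_mul_div, div_eq_iff this, h]
  ring

theorem orbitWeight_nonneg {φ : ℝ} (h0 : 0 < φ) (ω : Perm (Fin n)) : 0 ≤ B.orbitWeight φ ω :=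
  div_nonneg (mul_nonneg (by positivity) (prod_nonneg fun _ _ => by positivity)) (by positivity)

/-- The displacement of the element in position `p`, within its block. -/
noncomputable def localShift (ω ω' : Perm (Fin n)) (p : Fin n) : ℝ :=
  B.localRank ω' p - B.localRank ω p

/-- The Euclidean norm of the differences of the displacements of the matched positions. -/
noncomputable def mateShift (ω ω' : Perm (Fin n)) : ℝ :=
  √(∑ p ∈ B.left, (B.localShift ω ω' (B.mate p) - B.localShift ω ω' p) ^ 2)

theorem localShift_mul {g : Perm (Fin n)} (hg : ∀ p, B.block (g p) = B.block p)
    (ω ω' : Perm (Fin n)) (p : Fin n) :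
    B.localShift (ω * g) (ω' * g) p = B.localShift ω ω' (g p) := by
  rw [localShift, B.localRank_mul hg, B.localRank_mul hg, localShift]

/-- A flip only changes the signs of differences between mates, so `mateShift` is constant on
orbits. -/
theorem mateShift_mul_flip (ω ω' : Perm (Fin n)) (t : Finset (Fin n)) :
    B.mateShift (ω * B.flip t) (ω' * B.flip t) = B.mateShift ω ω' := by
  unfold mateShift
  congr 1
  refine sum_congr rfl fun p _ => ?_
  rw [B.localShift_mul (B.block_flip t), B.localShift_mul (B.block_flip t), B.flip_apply,
    B.flip_apply, B.mate_mate]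
  by_cases h : p ∈ t ∨ B.mate p ∈ t
  · rw [if_pos h, if_pos h.symm]; ring
  · rw [if_neg h, if_neg fun h' => h h'.symm]

theorem sum_left_mate_le {f : Fin n → ℝ} (hf : ∀ p, 0 ≤ f p) :
    ∑ p ∈ B.left, (f p + f (B.mate p)) ≤ ∑ p, f p := by
  rw [sum_add_distrib, ← sum_image (g := B.mate) (f := f) fun p _ q _ h => B.mate_injective h,
    ← sum_union]
  · exact sum_le_sum_of_subset_of_nonneg (subset_univ _) fun p _ _ => hf p
  · rw [disjoint_right]
    intro p hp hp'
    obtain ⟨q, hq, rfl⟩ := mem_image.1 hp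
    exact B.mate_notMem q hq hp'

theorem sum_mate_sub_sq_le (f : Fin n → ℝ) :
    ∑ p ∈ B.left, (f (B.mate p) - f p) ^ 2 ≤ 2 * ∑ p, f p ^ 2 := by
  have h := B.sum_left_mate_le (f := fun p => f p ^ 2) fun p => sq_nonneg _
  calc _ ≤ ∑ p ∈ B.left, 2 * (f p ^ 2 + f (B.mate p) ^ 2) :=
        sum_le_sum fun p _ => by nlinarith [sq_nonneg (f (B.mate p) + f p)]
    _ ≤ _ := by rw [← mul_sum]; linarith

theorem sum_coinMass_flipProb_ge {κ : ℝ} (hκ : 0 < κ) : ∃ c : ℝ, 0 < c ∧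
    ∀ {n : ℕ} (B : HalfBlocks n) {φ : ℝ}, 0 < φ → φ ≤ 1 →
      ∀ (ω ω' : Perm (Fin n)),
      (∀ p, κ ≤ φ ^ B.localRank ω p) → (∀ p, κ ≤ φ ^ B.localRank ω' p) →
      (1 - φ) ^ 2 * ∑ p, B.localShift ω ω' p ^ 2 ≤ 1 →
      c * ((1 - φ) * B.mateShift ω ω') ≤ ∑ t ∈ B.left.powerset,
        |coinMass (B.flipProb φ ω) B.left t - coinMass (B.flipProb φ ω') B.left t| := by
  set v := κ / 2 * (κ / 2) with hv
  set b := 1 / (8 * κ ^ 4) with hb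
  have hvpos : 0 < v := by positivity
  refine ⟨κ ^ 2 / 4 / (2 * (Real.exp (b / v) / v + 1)), by positivity, ?_⟩
  intro n B φ h0 h1 ω ω' hr hr' hu
  have hbd := fun p => oddsProb_bounds hκ h0 h1 (hr p) (hr (B.mate p))
  have hδ := fun p => abs_oddsProb_sub_bounds hκ h0 h1 (hr p) (hr (B.mate p)) (hr' p)
    (hr' (B.mate p))
  have he : 0 ≤ 1 - φ := by linarith
  have hV : ∑ p ∈ B.left, (B.flipProb φ ω' p - B.flipProb φ ω p) ^ 2 ≤ b := by
    calc _ ≤ ∑ p ∈ B.left, (1 / (4 * κ ^ 2)) ^ 2 * ((1 - φ) ^ 2 *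
          (B.localShift ω ω' (B.mate p) - B.localShift ω ω' p) ^ 2) := by
          refine sum_le_sum fun p _ => ?_
          rw [← sq_abs]
          refine (pow_le_pow_left₀ (abs_nonneg _) (hδ p).2 2).trans_eq ?_
          rw [mul_pow, mul_pow, sq_abs]
          rfl
      _ ≤ (1 / (4 * κ ^ 2)) ^ 2 * ((1 - φ) ^ 2 * (2 * ∑ p, B.localShift ω ω' p ^ 2)) := by
          rw [← mul_sum, ← mul_sum]
          gcongr
          exact B.sum_mate_sub_sq_le _
      _ = (1 / (4 * κ ^ 2)) ^ 2 * 2 * ((1 - φ) ^ 2 * ∑ p, B.localShift ω ω' p ^ 2) := by ring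
      _ ≤ (1 / (4 * κ ^ 2)) ^ 2 * 2 * 1 := by gcongr
      _ = b := by rw [hb]; field_simp; norm_num
  have hmain := sqrt_le_sum_abs_coinMass_sub (p := B.flipProb φ ω) (q := B.flipProb φ ω')
    (s := B.left) hvpos (fun p _ => lt_of_lt_of_le (by positivity) (hbd p).1)
    (fun p _ => by have := (hbd p).2; unfold flipProb; linarith)
    (fun p _ => mul_le_mul (hbd p).1 (hbd p).2 (by positivity)
      (le_trans (by positivity) (hbd p).1)) hV
  refine le_trans ?_ hmain
  rw [div_mul_eq_mul_div]
  gcongr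
  refine Real.le_sqrt_of_sq_le ?_
  have hR : B.mateShift ω ω' ^ 2 =
      ∑ p ∈ B.left, (B.localShift ω ω' (B.mate p) - B.localShift ω ω' p) ^ 2 :=
    Real.sq_sqrt (sum_nonneg fun _ _ => sq_nonneg _)
  rw [mul_pow, mul_pow, hR, mul_sum, mul_sum]
  refine sum_le_sum fun p _ => ?_
  rw [← sq_abs (B.flipProb φ ω' p - B.flipProb φ ω p)]
  refine le_trans (le_of_eq ?_) (pow_le_pow_left₀ (by positivity) (hδ p).1 2)
  rw [mul_pow, mul_pow, sq_abs]
  rfl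

theorem sum_abs_pow_crossCount_sub_ge {κ : ℝ} (hκ : 0 < κ) : ∃ c : ℝ, 0 < c ∧
    ∀ {n : ℕ} (B : HalfBlocks n) {φ : ℝ}, 0 < φ → φ ≤ 1 →
      (∀ ω p, κ ≤ φ ^ B.localRank ω p) → ∀ α β : Perm (Fin n),
      (∀ π, (1 - φ) ^ 2 * ∑ p, B.localShift (α * π) (β * π) p ^ 2 ≤ 1) →
      c * ((1 - φ) * ∑ π, φ ^ crossCount B.half (α * π) * B.mateShift (α * π) (β * π)) ≤
        ∑ π, |φ ^ crossCount B.half (α * π) - φ ^ crossCount B.half (β * π)| := by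
  obtain ⟨c, hc, H⟩ := sum_coinMass_flipProb_ge hκ
  refine ⟨c / 2, by positivity, ?_⟩
  intro n B φ h0 h1 hr α β hu
  -- Right multiplication by each flip permutes all `π`, so every sum is an average of sums over
  -- orbits.
  have orbit : ∀ f : Perm (Fin n) → ℝ, (#B.left.powerset : ℝ) * ∑ π, f π =
      ∑ π, ∑ t ∈ B.left.powerset, f (π * B.flip t) := by
    intro f
    rw [sum_comm, ← nsmul_eq_mul, ← sum_const]
    exact sum_congr rfl fun t _ => (Equiv.sum_comp (Equiv.mulRight (B.flip t)) f).symm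
  have hpos : (0 : ℝ) < #B.left.powerset := by
    exact_mod_cast card_pos.2 ⟨∅, empty_mem_powerset _⟩
  refine le_of_mul_le_mul_left ?_ hpos
  rw [orbit, show ∀ x y z w : ℝ, x * (y * (z * w)) = y * z * (x * w) by intros; ring, orbit,
    mul_sum]
  refine sum_le_sum fun π _ => ?_
  have e : ∀ γ : Perm (Fin n), ∀ t ∈ B.left.powerset,
      φ ^ crossCount B.half (γ * (π * B.flip t)) =
        B.orbitWeight φ (γ * π) * coinMass (B.flipProb φ (γ * π)) B.left t := fun γ t ht => by
    rw [← mul_assoc, B.pow_crossCount_mul_flip h0 _ (mem_powerset.1 ht)]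
  have hW := B.orbitWeight_nonneg h0 (α * π)
  calc c / 2 * (1 - φ) * ∑ t ∈ B.left.powerset, φ ^ crossCount B.half (α * (π * B.flip t)) *
        B.mateShift (α * (π * B.flip t)) (β * (π * B.flip t))
      = c / 2 * (1 - φ) * ∑ t ∈ B.left.powerset, coinMass (B.flipProb φ (α * π)) B.left t *
          (B.orbitWeight φ (α * π) * B.mateShift (α * π) (β * π)) := by
        congr 1
        refine sum_congr rfl fun t ht => ?_
        rw [e α t ht, ← mul_assoc α, ← mul_assoc β, B.mateShift_mul_flip]
        ring
    _ = B.orbitWeight φ (α * π) / 2 * (c * ((1 - φ) * B.mateShift (α * π) (β * π))) := by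
        rw [← sum_mul, sum_coinMass]; ring
    _ ≤ B.orbitWeight φ (α * π) / 2 * ∑ t ∈ B.left.powerset,
          |coinMass (B.flipProb φ (α * π)) B.left t - coinMass (B.flipProb φ (β * π)) B.left t| := by
        gcongr
        exact H B h0 h1 _ _ (hr _) (hr _) (hu π)
    _ ≤ ∑ t ∈ B.left.powerset,
          |B.orbitWeight φ (α * π) * coinMass (B.flipProb φ (α * π)) B.left t -
            B.orbitWeight φ (β * π) * coinMass (B.flipProb φ (β * π)) B.left t| := by
        refine half_mul_sum_abs_sub_le _ hW (sum_coinMass _ _) (sum_coinMass _ _) fun t ht => ?_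
        refine coinMass_nonneg (fun p _ => ?_) (fun p _ => ?_) (mem_powerset.1 ht)
        · exact le_trans (by positivity) (oddsProb_bounds hκ h0 h1 (hr _ _) (hr _ _)).1
        · have := (oddsProb_bounds hκ h0 h1 (hr (β * π) p) (hr (β * π) (B.mate p))).2
          unfold flipProb
          linarith
    _ = _ := sum_congr rfl fun t ht => by rw [e α t ht, e β t ht]

end HalfBlocks

/-! ### Displacements as sums of changes of order -/

/-- The change of the relative order of the elements in positions `p` and `q`. -/
def orderShift (ω ω' : Perm (Fin n)) (p q : Fin n) : ℝ :=
  (if ω' q < ω' p then 1 else 0) - (if ω q < ω p then 1 else 0)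

theorem orderShift_swap (ω ω' : Perm (Fin n)) (p q : Fin n) :
    orderShift ω ω' p q = -orderShift ω ω' q p := by
  unfold orderShift
  rcases eq_or_ne p q with rfl | h
  · simp
  · have h1 := ω.injective.ne h
    have h2 := ω'.injective.ne h
    rcases h1.lt_or_gt with a | a <;> rcases h2.lt_or_gt with b | b <;>
      simp [a, b, a.not_gt, b.not_gt]

/-- The displacement of the element in position `p`. -/
def shift (ω ω' : Perm (Fin n)) (p : Fin n) : ℝ := ((ω' p : ℕ) : ℝ) - ((ω p : ℕ) : ℝ)

/-- If `p` overtakes `q`, then `p` is displaced further than `q`. -/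
theorem shift_sub_mul_orderShift_nonneg (ω ω' : Perm (Fin n)) (p q : Fin n) :
    0 ≤ (shift ω ω' p - shift ω ω' q) * orderShift ω ω' p q := by
  unfold shift orderShift
  have cast : ∀ a b : Fin n, a < b → ((a : ℕ) : ℝ) < ((b : ℕ) : ℝ) := fun a b h => by
    exact_mod_cast h
  have cast' : ∀ a b : Fin n, ¬ a < b → ((b : ℕ) : ℝ) ≤ ((a : ℕ) : ℝ) := fun a b h => by
    exact_mod_cast not_lt.1 h
  split_ifs with h1 h2 h2
  · simp
  · have := cast _ _ h1; have := cast' _ _ h2; linarith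
  · have := cast' _ _ h1; have := cast _ _ h2; linarith
  · simp

theorem sum_mul_sum_antisymm {ι : Type*} (s : Finset ι) (f : ι → ℝ) (a : ι → ι → ℝ)
    (ha : ∀ p q, a p q = -a q p) :
    ∑ p ∈ s, f p * ∑ q ∈ s, a p q = 1 / 2 * ∑ p ∈ s, ∑ q ∈ s, (f p - f q) * a p q := by
  have h1 : ∑ p ∈ s, ∑ q ∈ s, f q * a p q = -∑ p ∈ s, f p * ∑ q ∈ s, a p q := by
    rw [sum_comm, ← sum_neg_distrib]
    refine sum_congr rfl fun p _ => ?_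
    rw [mul_sum, ← sum_neg_distrib]
    exact sum_congr rfl fun q _ => by rw [ha q p]; ring
  simp only [sub_mul, sum_sub_distrib, h1, ← mul_sum]
  ring

theorem sum_orderShift (ω ω' : Perm (Fin n)) (p : Fin n) :
    ∑ q, orderShift ω ω' p q = shift ω ω' p := by
  have key : ∀ ω : Perm (Fin n), ∑ q, (if ω q < ω p then (1 : ℝ) else 0) = ((ω p : ℕ) : ℝ) := by
    intro ω
    rw [sum_boole, card_filter_comp ω fun q => q < ω p, ← Fin.card_Iio]
    congr 2
    ext q
    simp
  simp only [orderShift, sum_sub_distrib, key, shift]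

theorem sum_shift_sq (ω ω' : Perm (Fin n)) : ∑ p, shift ω ω' p ^ 2 =
    1 / 2 * ∑ p, ∑ q, (shift ω ω' p - shift ω ω' q) * orderShift ω ω' p q := by
  rw [← sum_mul_sum_antisymm _ _ _ (orderShift_swap ω ω')]
  exact sum_congr rfl fun p _ => by rw [sum_orderShift, sq]

namespace HalfBlocks

variable (B : HalfBlocks n)

theorem localShift_eq (ω ω' : Perm (Fin n)) (p : Fin n) : B.localShift ω ω' p =
    ∑ q, if B.block q = B.block p then orderShift ω ω' p q else 0 := by
  have key : ∀ ω : Perm (Fin n), (B.localRank ω p : ℝ) =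
      ∑ q, if B.block q = B.block p then (if ω q < ω p then (1 : ℝ) else 0) else 0 := by
    intro ω
    rw [localRank, ← sum_boole]
    exact sum_congr rfl fun q _ => by rw [ite_and]
  rw [localShift, key, key, ← sum_sub_distrib]
  refine sum_congr rfl fun q _ => ?_
  split_ifs <;> simp [orderShift, *]

theorem sum_mul_localShift (ω ω' : Perm (Fin n)) (f : Fin n → ℝ) :
    ∑ p, f p * B.localShift ω ω' p = 1 / 2 * ∑ p, ∑ q,
      if B.block q = B.block p then (f p - f q) * orderShift ω ω' p q else 0 := by
  simp only [localShift_eq]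
  rw [sum_mul_sum_antisymm]
  · simp only [mul_ite, mul_zero]
  · intro p q
    by_cases h : B.block q = B.block p
    · rw [if_pos h, if_pos h.symm, orderShift_swap]
    · rw [if_neg h, if_neg fun h' => h h'.symm, neg_zero]

/-- Changes of order are antisymmetric, so they cancel within a block. -/
theorem sum_block_localShift (ω ω' : Perm (Fin n)) (b : ℕ) :
    ∑ p, (if B.block p = b then B.localShift ω ω' p else 0) = 0 := by
  have h := B.sum_mul_localShift ω ω' fun p => if B.block p = b then 1 else 0
  simp only [ite_mul, one_mul, zero_mul] at h
  rw [h]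
  refine mul_eq_zero_of_right _ (sum_eq_zero fun p _ => sum_eq_zero fun q _ => ?_)
  split_ifs with h1 h2 h3 h3 <;> simp_all

theorem localRank_add_le {ω : Perm (Fin n)} {p q : Fin n} (hb : B.block p = B.block q)
    (h : ω q ≤ ω p) : B.localRank ω p + ω q ≤ B.localRank ω q + ω p := by
  have h1 : B.localRank ω p ≤ B.localRank ω q + #{z : Fin n | ω z ∈ Finset.Ico (ω q) (ω p)} := by
    unfold localRank
    refine le_trans (card_le_card ?_) (card_union_le _ _)
    intro z
    simp only [mem_union, mem_filter, mem_univ, true_and, Finset.mem_Ico, hb]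
    rintro ⟨a, b⟩
    rcases lt_or_ge (ω z) (ω q) with c | c
    · exact Or.inl ⟨a, c⟩
    · exact Or.inr ⟨c, b⟩
  rw [card_filter_comp ω fun z => z ∈ Finset.Ico (ω q) (ω p)] at h1
  simp only [filter_univ_mem, Fin.card_Ico] at h1
  have : (ω q : ℕ) ≤ ω p := h
  omega

/-- When the order changes, the difference of displacements is the gap before plus the gap after,
and local gaps are at most global ones. -/
theorem localShift_sub_mul_orderShift_le (ω ω' : Perm (Fin n)) {p q : Fin n}
    (hb : B.block q = B.block p) :
    (B.localShift ω ω' p - B.localShift ω ω' q) * orderShift ω ω' p q ≤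
      (shift ω ω' p - shift ω ω' q) * orderShift ω ω' p q := by
  have key : ∀ (ω : Perm (Fin n)) {p q : Fin n}, B.block p = B.block q → ω q ≤ ω p →
      (B.localRank ω p : ℝ) + ((ω q : ℕ) : ℝ) ≤ B.localRank ω q + ((ω p : ℕ) : ℝ) :=
    fun ω p q h1 h2 => by exact_mod_cast B.localRank_add_le h1 h2
  unfold shift orderShift localShift
  split_ifs with h1 h2 h2
  · simp
  · have := key ω' hb.symm h1.le; have := key ω hb (not_lt.1 h2); linarith
  · have := key ω' hb (not_lt.1 h1); have := key ω hb.symm h2.le; linarith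
  · simp

theorem sum_localShift_sq_le (ω ω' : Perm (Fin n)) :
    ∑ p, B.localShift ω ω' p ^ 2 ≤ ∑ p, shift ω ω' p ^ 2 := by
  rw [sum_shift_sq]
  simp only [sq]
  rw [sum_mul_localShift]
  gcongr with p _ q _
  split_ifs with h
  · exact B.localShift_sub_mul_orderShift_le ω ω' h
  · exact shift_sub_mul_orderShift_nonneg ω ω' p q

/-- The Euclidean norm of the displacements within the blocks. -/
noncomputable def localNorm (ω ω' : Perm (Fin n)) : ℝ := √(∑ p, B.localShift ω ω' p ^ 2)

/-- The left side is the inner product of `shift` and `localShift`; Cauchy-Schwarz bounds it. -/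
theorem sum_sameBlock_le (ω ω' : Perm (Fin n)) :
    1 / 2 * ∑ p, ∑ q, (if B.block q = B.block p then
      (shift ω ω' p - shift ω ω' q) * orderShift ω ω' p q else 0) ≤
      √(∑ p, shift ω ω' p ^ 2) * B.localNorm ω ω' := by
  rw [← sum_mul_localShift]
  exact Real.sum_mul_le_sqrt_mul_sqrt _ _ _

/-- By `crossCount_half_add` only the ranks at `i` and `j` matter, and each changes by at most `ℓ`.
-/
theorem crossCount_half_mul_swap_le {ℓ : ℕ} {ω : Perm (Fin n)} (hℓ : ∀ p, B.localRank ω p ≤ ℓ)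
    {i j : Fin n} (hij : B.block i = B.block j) :
    crossCount B.half (ω * swap i j) ≤ crossCount B.half ω + 2 * ℓ := by
  have hs : ∀ p, B.block (swap i j p) = B.block p := by
    intro p
    rw [swap_apply_def]
    split_ifs with h1 h2
    · rw [h1, hij]
    · rw [h2, hij]
    · rfl
  have h1 := B.crossCount_half_add ω
  have h2 := B.crossCount_half_add (ω * swap i j)
  rw [crossCount_mul hs] at h2
  have h3 : ∑ p ∈ B.left, B.localRank (ω * swap i j) p ≤ ∑ p ∈ B.left, B.localRank ω p + 2 * ℓ := by
    calc _ ≤ ∑ p ∈ B.left,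
          (B.localRank ω p + ((if p = i then ℓ else 0) + if p = j then ℓ else 0)) := by
          refine sum_le_sum fun p _ => ?_
          rw [B.localRank_mul hs, swap_apply_def]
          have := hℓ i
          have := hℓ j
          split_ifs with h1 h2 <;> omega
      _ ≤ _ := by
          rw [sum_add_distrib, sum_add_distrib, sum_ite_eq', sum_ite_eq']
          split_ifs <;> omega
  omega

theorem sum_eq_sum_left_add_mate {f : Fin n → ℝ} (hf : ∀ p, B.mate p = p → f p = 0) :
    ∑ p, f p = ∑ p ∈ B.left, (f p + f (B.mate p)) := by
  rw [sum_add_distrib, ← sum_image (g := B.mate) (f := f) fun p _ q _ h => B.mate_injective h,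
    ← sum_union]
  · refine (sum_subset (subset_univ _) fun p _ hp => ?_).symm
    rw [mem_union, not_or] at hp
    rcases B.mate_mem p hp.1 with h | h
    · exact hf p h
    · exact absurd (mem_image.2 ⟨_, h, B.mate_mate p⟩) hp.2
  · rw [disjoint_right]
    intro p hp hp'
    obtain ⟨q, hq, rfl⟩ := mem_image.1 hp
    exact B.mate_notMem q hq hp'

theorem sum_abs_mul_abs_mate_sub_le (ω ω' : Perm (Fin n)) :
    ∑ p, |B.localShift ω ω' p| * |B.localShift ω ω' p - B.localShift ω ω' (B.mate p)| ≤
      2 * (B.localNorm ω ω' * B.mateShift ω ω') := by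
  have h := Real.sum_mul_le_sqrt_mul_sqrt univ (fun p => |B.localShift ω ω' p|)
    fun p => |B.localShift ω ω' p - B.localShift ω ω' (B.mate p)|
  refine h.trans ?_
  simp only [sq_abs]
  rw [B.sum_eq_sum_left_add_mate (f := fun p =>
    (B.localShift ω ω' p - B.localShift ω ω' (B.mate p)) ^ 2) (fun p hp => by simp [hp])]
  have e : ∑ p ∈ B.left, ((B.localShift ω ω' p - B.localShift ω ω' (B.mate p)) ^ 2 +
      (B.localShift ω ω' (B.mate p) - B.localShift ω ω' (B.mate (B.mate p))) ^ 2) =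
      2 * ∑ p ∈ B.left, (B.localShift ω ω' (B.mate p) - B.localShift ω ω' p) ^ 2 := by
    rw [mul_sum]
    exact sum_congr rfl fun p _ => by rw [B.mate_mate]; ring
  rw [e, Real.sqrt_mul zero_le_two]
  have h2 : √2 ≤ 2 := Real.sqrt_le_iff.2 ⟨by norm_num, by norm_num⟩
  calc B.localNorm ω ω' * (√2 * B.mateShift ω ω') ≤ B.localNorm ω ω' * (2 * B.mateShift ω ω') := by
        have : 0 ≤ B.localNorm ω ω' := Real.sqrt_nonneg _
        have : 0 ≤ B.mateShift ω ω' := Real.sqrt_nonneg _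
        gcongr
    _ = _ := by ring

theorem localNorm_mul {g : Perm (Fin n)} (hg : ∀ p, B.block (g p) = B.block p)
    (ω ω' : Perm (Fin n)) : B.localNorm (ω * g) (ω' * g) = B.localNorm ω ω' := by
  unfold localNorm
  simp only [B.localShift_mul hg]
  rw [Equiv.sum_comp g fun p => B.localShift ω ω' p ^ 2]

theorem block_swap {i j : Fin n} (hij : B.block i = B.block j) (p : Fin n) :
    B.block (swap i j p) = B.block p := by
  rw [swap_apply_def]
  split_ifs with h1 h2
  · rw [h1, hij]
  · rw [h2, hij]
  · rfl

theorem localShift_eq_zero {p : Fin n} (hp : ∀ q, B.block q = B.block p → q = p)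
    (ω ω' : Perm (Fin n)) : B.localShift ω ω' p = 0 := by
  have := B.sum_block_localShift ω ω' (B.block p)
  rwa [sum_eq_single p, if_pos rfl] at this
  · intro q _ hq
    rw [if_neg fun h => hq (hp q h)]
  · simp

/-- Swaps inside a block change the weight by a bounded factor. This replaces a uniformly random
matching. -/
theorem mul_sum_le_sum_swap {φ : ℝ} (h0 : 0 < φ) (h1 : φ ≤ 1) {ℓ : ℕ}
    (hℓ : ∀ ω p, B.localRank ω p ≤ ℓ) {i j : Fin n} (hij : B.block i = B.block j)
    (α : Perm (Fin n)) {F : Perm (Fin n) → ℝ} (hF : ∀ π, 0 ≤ F π) :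
    φ ^ (2 * ℓ) * ∑ π, φ ^ crossCount B.half (α * π) * F (π * swap i j) ≤
      ∑ π, φ ^ crossCount B.half (α * π) * F π := by
  rw [← Equiv.sum_comp (Equiv.mulRight (swap i j)) fun π => φ ^ crossCount B.half (α * π) * F π,
    mul_sum]
  refine sum_le_sum fun π _ => ?_
  rw [← mul_assoc, Equiv.coe_mulRight, ← mul_assoc]
  refine mul_le_mul_of_nonneg_right ?_ (hF _)
  rw [← pow_add]
  refine pow_le_pow_of_le_one h0.le h1 ?_
  rw [add_comm]
  exact B.crossCount_half_mul_swap_le (hℓ _) hij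

/-- On average, the displacements of matched positions differ as much as if they were matched at
random, so by the order of the displacements themselves. -/
theorem sum_mul_localNorm_le {φ : ℝ} (h0 : 0 < φ) (h1 : φ ≤ 1) {ℓ : ℕ}
    (hℓ : ∀ ω p, B.localRank ω p ≤ ℓ) (α β : Perm (Fin n)) :
    (φ ^ (2 * ℓ)) ^ 2 / 4 *
      ∑ π, φ ^ crossCount B.half (α * π) * B.localNorm (α * π) (β * π) ≤
      ∑ π, φ ^ crossCount B.half (α * π) * B.mateShift (α * π) (β * π) := by
  set κ := φ ^ (2 * ℓ) with hκ
  have hκ0 : 0 < κ := by positivity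
  have hκ1 : κ ≤ 1 := pow_le_one₀ h0.le h1
  set P : Perm (Fin n) → ℝ := fun π => φ ^ crossCount B.half (α * π) with hP
  set N : Perm (Fin n) → ℝ := fun π => B.localNorm (α * π) (β * π) with hN
  set u : Perm (Fin n) → Fin n → ℝ := fun π => B.localShift (α * π) (β * π) with hu
  have hN0 : ∀ π, 0 ≤ N π := fun π => Real.sqrt_nonneg _
  have hP0 : ∀ π, 0 ≤ P π := fun π => by positivity
  have hNs : ∀ {i j}, B.block i = B.block j → ∀ π, N (π * swap i j) = N π := fun h π => by
    simp only [hN, ← mul_assoc]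
    exact B.localNorm_mul (B.block_swap h) _ _
  have hus : ∀ {i j}, B.block i = B.block j → ∀ π p, u (π * swap i j) p = u π (swap i j p) :=
    fun h π p => by
      simp only [hu, ← mul_assoc]
      exact B.localShift_mul (B.block_swap h) _ _ p
  set T : Fin n → ℝ := fun p => ∑ π, P π * ((N π)⁻¹ * u π p ^ 2) with hT
  -- Dividing by `N`, which is invariant under swaps inside a block, turns quadratic bounds into
  -- bounds on the norms themselves.
  set M : Fin n → ℝ := fun p => ∑ π, P π * ((N π)⁻¹ * (|u π p| * |u π p - u π (B.mate p)|)) with hM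
  have hT0 : ∀ p, 0 ≤ T p := fun p => sum_nonneg fun π _ =>
    mul_nonneg (hP0 π) (mul_nonneg (inv_nonneg.2 (hN0 π)) (sq_nonneg _))
  have hM0 : ∀ p, 0 ≤ M p := fun p => sum_nonneg fun π _ =>
    mul_nonneg (hP0 π) (mul_nonneg (inv_nonneg.2 (hN0 π)) (by positivity))
  have step2 : ∀ p q, B.block p = B.block q → κ * T p ≤ T q := by
    intro p q hpq
    have := B.mul_sum_le_sum_swap h0 h1 hℓ hpq α (F := fun π => (N π)⁻¹ * u π q ^ 2)
      fun π => mul_nonneg (inv_nonneg.2 (hN0 π)) (sq_nonneg _)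
    simpa only [hNs hpq, hus hpq, swap_apply_right] using this
  -- Since `u` sums to zero over the block, `u π p` is the mean of `u π p - u π q` over `q` in it;
  -- swapping `q` with the mate of `p` compares every such `q` with the mate.
  have step1 : ∀ p, B.mate p ≠ p → κ * T p ≤ M p := by
    intro p hp
    have a : ∀ q, B.block q = B.block p →
        κ * ∑ π, P π * ((N π)⁻¹ * (|u π p| * |u π p - u π q|)) ≤ M p := by
      intro q hq
      rcases eq_or_ne q p with rfl | hqp
      · simpa using hM0 q
      · have hqm : B.block (B.mate p) = B.block q := by rw [B.block_mate, hq]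
        have := B.mul_sum_le_sum_swap h0 h1 hℓ hqm α
          (F := fun π => (N π)⁻¹ * (|u π p| * |u π p - u π (B.mate p)|))
          fun π => mul_nonneg (inv_nonneg.2 (hN0 π)) (by positivity)
        simpa only [hNs hqm, hus hqm, swap_apply_left,
          swap_apply_of_ne_of_ne (Ne.symm hp) (Ne.symm hqp)] using this
    set J : Finset (Fin n) := {q | B.block q = B.block p} with hJ
    have hpJ : p ∈ J := by simp [hJ]
    have hJpos : (0 : ℝ) < #J := by exact_mod_cast card_pos.2 ⟨p, hpJ⟩
    have b : ∀ π, #J * u π p ^ 2 ≤ ∑ q ∈ J, |u π p| * |u π p - u π q| := by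
      intro π
      have hz : ∑ q ∈ J, u π q = 0 := by
        rw [hJ, sum_filter]
        exact B.sum_block_localShift _ _ _
      calc #J * u π p ^ 2 = |u π p| * |∑ q ∈ J, (u π p - u π q)| := by
            rw [sum_sub_distrib, hz, sum_const, nsmul_eq_mul, sub_zero, abs_mul, Nat.abs_cast,
              ← sq_abs]
            ring
        _ ≤ |u π p| * ∑ q ∈ J, |u π p - u π q| := by
            gcongr
            exact abs_sum_le_sum_abs _ _
        _ = _ := mul_sum _ _ _
    refine le_of_mul_le_mul_left ?_ hJpos
    calc #J * (κ * T p) = κ * ∑ π, P π * ((N π)⁻¹ * (#J * u π p ^ 2)) := by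
          simp only [hT, mul_sum]
          exact sum_congr rfl fun π _ => by ring
      _ ≤ κ * ∑ π, P π * ((N π)⁻¹ * ∑ q ∈ J, |u π p| * |u π p - u π q|) := by
          gcongr with π
          · exact inv_nonneg.2 (hN0 π)
          · exact b π
      _ = ∑ q ∈ J, κ * ∑ π, P π * ((N π)⁻¹ * (|u π p| * |u π p - u π q|)) := by
          simp only [mul_sum]
          rw [sum_comm]
      _ ≤ ∑ q ∈ J, M p := sum_le_sum fun q hq => a q (mem_filter.1 hq).2
      _ = #J * M p := by rw [sum_const, nsmul_eq_mul]
  have step3 : κ * ∑ p, T p ≤ 2 * ∑ p with B.mate p ≠ p, T p := by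
    -- Charge an unmatched position to another one in its block. A block has at most one unmatched
    -- position, so the charging is injective; a block of one position contributes 0.
    have hfix : κ * ∑ p with B.mate p = p, T p ≤ ∑ p with B.mate p ≠ p, T p := by
      have hex : ∀ p, ∃ q, B.block q = B.block p ∧ (T p ≠ 0 → q ≠ p) := by
        intro p
        by_cases h : ∀ q, B.block q = B.block p → q = p
        · refine ⟨p, rfl, fun h' => absurd ?_ h'⟩
          simp only [hT, hu, B.localShift_eq_zero h]
          simp
        · push Not at h
          obtain ⟨q, hq, hne⟩ := h
          exact ⟨q, hq, fun _ => hne⟩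
      choose f hf hne using hex
      set A : Finset (Fin n) := {p | B.mate p = p ∧ T p ≠ 0} with hA
      have hinj : Set.InjOn f A := by
        intro p hp q hq hpq
        rw [mem_coe, hA, mem_filter] at hp hq
        exact B.eq_of_mate_eq p q hp.2.1 hq.2.1 (by rw [← hf p, ← hf q, hpq])
      calc κ * ∑ p with B.mate p = p, T p = κ * ∑ p ∈ A, T p := by
            congr 1
            rw [hA, ← filter_filter, sum_filter_ne_zero]
        _ ≤ ∑ p ∈ A, T (f p) := by
            rw [mul_sum]
            exact sum_le_sum fun p _ => step2 p (f p) (hf p).symm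
        _ = ∑ q ∈ A.image f, T q := (sum_image hinj).symm
        _ ≤ _ := by
            refine sum_le_sum_of_subset_of_nonneg ?_ fun p _ _ => hT0 p
            intro q hq
            obtain ⟨p, hp, rfl⟩ := mem_image.1 hq
            rw [hA, mem_filter] at hp
            rw [mem_filter]
            exact ⟨mem_univ _, fun h => hne p hp.2.2
              (B.eq_of_mate_eq _ _ h hp.2.1 (hf p))⟩
    rw [← sum_filter_add_sum_filter_not univ fun p => B.mate p = p, mul_add]
    have : κ * ∑ p with ¬B.mate p = p, T p ≤ ∑ p with B.mate p ≠ p, T p :=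
      mul_le_of_le_one_left (sum_nonneg fun p _ => hT0 p) hκ1
    linarith
  have step4 : κ * ∑ p with B.mate p ≠ p, T p ≤ ∑ p, M p := by
    rw [mul_sum]
    refine le_trans (sum_le_sum fun p hp => step1 p (mem_filter.1 hp).2) ?_
    exact sum_le_sum_of_subset_of_nonneg (subset_univ _) fun p _ _ => hM0 p
  have hTsum : ∑ p, T p = ∑ π, P π * N π := by
    simp only [hT]
    rw [sum_comm]
    refine sum_congr rfl fun π _ => ?_
    rw [← mul_sum, ← mul_sum]
    have : ∑ p, u π p ^ 2 = N π ^ 2 := (Real.sq_sqrt (sum_nonneg fun _ _ => sq_nonneg _)).symm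
    rw [this]
    -- For `N π = 0` the convention `0⁻¹ = 0` gives 0 on both sides.
    rcases (hN0 π).eq_or_lt with h | h
    · rw [← h]; simp
    · field_simp
  have hMsum : ∑ p, M p ≤ 2 * ∑ π, P π * B.mateShift (α * π) (β * π) := by
    simp only [hM]
    rw [sum_comm, mul_sum]
    refine sum_le_sum fun π _ => ?_
    rw [← mul_sum, ← mul_sum]
    have h := B.sum_abs_mul_abs_mate_sub_le (α * π) (β * π)
    have hR : 0 ≤ B.mateShift (α * π) (β * π) := Real.sqrt_nonneg _
    have h' : (N π)⁻¹ * ∑ p, |u π p| * |u π p - u π (B.mate p)| ≤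
        2 * B.mateShift (α * π) (β * π) := by
      calc _ ≤ (N π)⁻¹ * (2 * (N π * B.mateShift (α * π) (β * π))) := by
            have := inv_nonneg.2 (hN0 π)
            gcongr
        _ = ((N π)⁻¹ * N π) * (2 * B.mateShift (α * π) (β * π)) := by ring
        _ ≤ 1 * (2 * B.mateShift (α * π) (β * π)) := by
            gcongr
            exact inv_mul_le_one
        _ = _ := one_mul _
    calc _ ≤ P π * (2 * B.mateShift (α * π) (β * π)) := by
          have := hP0 π
          gcongr
      _ = _ := by ring
  rw [hTsum] at step3
  have : κ * (κ * ∑ π, P π * N π) ≤ κ * (2 * ∑ p with B.mate p ≠ p, T p) := by gcongr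
  change κ ^ 2 / 4 * ∑ π, P π * N π ≤ ∑ π, P π * B.mateShift (α * π) (β * π)
  nlinarith

end HalfBlocks

/-! ### Concentration of positions in the Mallows model -/

/-- The pairs ordered in opposite ways by `r` and `P`. -/
def discordant (r P : Fin n → ℤ) : Finset (Fin n × Fin n) :=
  {u | r u.1 < r u.2 ∧ P u.2 < P u.1}

/-- The elements that `r` puts before `x` and `P` puts after `x`. -/
def delayed (r P : Fin n → ℤ) (x : Fin n) : Finset (Fin n) := {z | r z < r x ∧ P x < P z}

theorem mem_discordant {r P : Fin n → ℤ} {u : Fin n × Fin n} :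
    u ∈ discordant r P ↔ r u.1 < r u.2 ∧ P u.2 < P u.1 := by simp [discordant]

theorem mem_delayed {r P : Fin n → ℤ} {x z : Fin n} :
    z ∈ delayed r P x ↔ r z < r x ∧ P x < P z := by simp [delayed]

/-- The swap removes the pair (y, x). A new pair (x, v) arises only for v between x and y, and
replaces (y, v), which the swap makes concordant. Minimality of `y` excludes new pairs (u, y). -/
theorem card_discordant_swap_lt {r P : Fin n → ℤ} (hP : Function.Injective P) {x y : Fin n}
    (hy : y ∈ delayed r P x) (hmin : ∀ z ∈ delayed r P x, P y ≤ P z) :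
    #(discordant r (P ∘ swap x y)) + 1 ≤ #(discordant r P) := by
  simp only [mem_delayed] at hy hmin
  obtain ⟨hr, hPxy⟩ := hy
  have hxy : x ≠ y := fun h => hr.ne (by rw [h])
  have hmem : (y, x) ∈ discordant r P := mem_discordant.2 ⟨hr, hPxy⟩
  have hx : (P ∘ swap x y) x = P y := by simp
  have hy : (P ∘ swap x y) y = P x := by simp
  have ho : ∀ z, z ≠ x → z ≠ y → (P ∘ swap x y) z = P z := fun z h1 h2 => by
    simp [swap_apply_of_ne_of_ne h1 h2]
  generalize P ∘ swap x y = P' at hx hy ho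
  have hne : ∀ u v, u ≠ v → P u ≠ P v := fun u v h => hP.ne h
  rw [← card_erase_add_one hmem]
  refine Nat.add_le_add_right (card_le_card_of_injOn
    (fun u => if u.1 = x ∧ P x < P u.2 ∧ P u.2 < P y then (y, u.2) else u) ?_ ?_) 1
  · rintro ⟨u, v⟩ h
    rw [mem_coe, mem_discordant] at h
    rw [mem_coe, mem_erase, mem_discordant]
    dsimp only at h ⊢
    grind
  · rintro ⟨u, v⟩ h ⟨u', v'⟩ h' he
    rw [mem_coe, mem_discordant] at h h'
    dsimp only at h h' he
    grind

theorem card_delayed_le_swap {r P : Fin n → ℤ} {x y : Fin n}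
    (hmin : ∀ z ∈ delayed r P x, P y ≤ P z) (hP : Function.Injective P) :
    #(delayed r P x) ≤ 1 + #(delayed r (P ∘ swap x y) x) := by
  have : delayed r P x ⊆ insert y (delayed r (P ∘ swap x y) x) := by
    intro z hz
    rw [mem_insert]
    by_cases h : z = y
    · exact Or.inl h
    · right
      have h1 := hmin z hz
      rw [mem_delayed] at hz ⊢
      have hzx : z ≠ x := fun e => hz.1.ne (by rw [e])
      simp only [Function.comp, swap_apply_left, swap_apply_of_ne_of_ne hzx h]
      exact ⟨hz.1, lt_of_le_of_ne h1 fun e => h (hP e).symm⟩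
  refine (card_le_card this).trans ((card_insert_le _ _).trans ?_)
  rw [add_comm]

/-- In the Mallows model, the number of elements overtaken by `x` is dominated by a geometric
random variable. -/
theorem sum_pow_discordant_mul_delayed_le {φ : ℝ} (h0 : 0 < φ) (h1 : φ ≤ 1) {r g : Fin n → ℤ}
    (hg : Function.Injective g) (x : Fin n) :
    (1 - φ) * ∑ π : Perm (Fin n), φ ^ #(discordant r (g ∘ π.symm)) *
      (#(delayed r (g ∘ π.symm) x) : ℝ) ≤
      ∑ π : Perm (Fin n), φ ^ #(discordant r (g ∘ π.symm)) := by
  have hinj : ∀ π : Perm (Fin n), Function.Injective (g ∘ π.symm) := fun π =>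
    hg.comp π.symm.injective
  have hex : ∀ π : Perm (Fin n), ∃ y, (delayed r (g ∘ π.symm) x).Nonempty →
      y ∈ delayed r (g ∘ π.symm) x ∧
        ∀ z ∈ delayed r (g ∘ π.symm) x, (g ∘ π.symm) y ≤ (g ∘ π.symm) z := by
    intro π
    by_cases h : (delayed r (g ∘ π.symm) x).Nonempty
    · obtain ⟨y, hy⟩ := exists_min_image _ (g ∘ π.symm) h
      exact ⟨y, fun _ => hy⟩
    · exact ⟨x, fun h' => absurd h' h⟩
  choose y hy using hex
  set f : Perm (Fin n) → Perm (Fin n) := fun π => swap x (y π) * π with hf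
  have hfs : ∀ π, g ∘ (f π).symm = (g ∘ π.symm) ∘ swap x (y π) := fun π => by
    funext z
    simp [hf, Perm.mul_def]
  set A : Finset (Perm (Fin n)) := {π | (delayed r (g ∘ π.symm) x).Nonempty} with hA
  -- The image determines `y π`: it is the last element before `x` in the image among those that `r`
  -- puts before `x`. An earlier candidate would contradict the minimal choice of `y`.
  have hfinj : Set.InjOn f A := by
    have key : ∀ π ∈ A, ∀ π' ∈ A, f π = f π' → y π ≠ y π' →
        (g ∘ (f π).symm) (y π) < (g ∘ (f π).symm) (y π') → False := by
      intro π hπ π' hπ' he hne hlt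
      have e1 := hfs π
      have e2 := hfs π'
      rw [← he] at e2
      obtain ⟨a1, b1⟩ := hy π (mem_filter.1 hπ).2
      obtain ⟨a2, -⟩ := hy π' (mem_filter.1 hπ').2
      rw [mem_delayed] at a1 a2
      have hy'x : y π' ≠ x := fun h => a2.1.ne (by rw [h])
      have v1 : (g ∘ (f π).symm) x = (g ∘ π.symm) (y π) := by rw [e1]; simp
      have v2 : (g ∘ (f π).symm) (y π) = (g ∘ π.symm) x := by rw [e1]; simp
      have v3 : (g ∘ (f π).symm) (y π') = (g ∘ π.symm) (y π') := by
        rw [e1, Function.comp_apply, swap_apply_of_ne_of_ne hy'x hne.symm]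
      have v4 : (g ∘ (f π).symm) x = (g ∘ π'.symm) (y π') := by rw [e2]; simp
      have v5 : (g ∘ (f π).symm) (y π') = (g ∘ π'.symm) x := by rw [e2]; simp
      have := b1 (y π') (mem_delayed.2 ⟨a2.1, by rw [← v2, ← v3]; exact hlt⟩)
      rw [← v1, ← v3, v5, v4] at this
      exact absurd a2.2 (not_lt.2 this)
    intro π hπ π' hπ' he
    by_cases hne : y π = y π'
    · simp only [hf] at he
      rw [hne] at he
      exact mul_left_cancel he
    · exfalso
      rcases lt_trichotomy ((g ∘ (f π).symm) (y π)) ((g ∘ (f π).symm) (y π')) with h | h | h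
      · exact key π hπ π' hπ' he hne h
      · exact hne (hinj (f π) h)
      · exact key π' hπ' π hπ he.symm (Ne.symm hne) (by rw [← he]; exact h)
  set W : Perm (Fin n) → ℝ := fun π => φ ^ #(discordant r (g ∘ π.symm)) with hW
  set D : Perm (Fin n) → ℝ := fun π => (#(delayed r (g ∘ π.symm) x) : ℝ) with hD
  have hW0 : ∀ π, 0 ≤ W π := fun π => by positivity
  have hD0 : ∀ π, 0 ≤ D π := fun π => Nat.cast_nonneg _
  -- Each swap gains a factor `φ` and loses at most one delayed element; solving E D ≤ φ (1 + E D)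
  -- gives the claim.
  have main : ∑ π, W π * D π ≤ φ * ∑ π, W π * (1 + D π) := by
    calc ∑ π, W π * D π = ∑ π ∈ A, W π * D π := by
          refine (sum_subset (subset_univ _) fun π _ hπ => ?_).symm
          have : delayed r (g ∘ π.symm) x = ∅ := by
            rw [← not_nonempty_iff_eq_empty]
            exact fun h => hπ (mem_filter.2 ⟨mem_univ _, h⟩)
          simp [hD, this]
      _ ≤ ∑ π ∈ A, φ * (W (f π) * (1 + D (f π))) := by
          refine sum_le_sum fun π hπ => ?_
          obtain ⟨a, b⟩ := hy π (mem_filter.1 hπ).2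
          have c1 := card_discordant_swap_lt (hinj π) a b
          have c2 := card_delayed_le_swap b (hinj π)
          rw [← hfs] at c1 c2
          have d1 : W π ≤ φ * W (f π) := by
            simp only [hW]
            rw [← pow_succ']
            exact pow_le_pow_of_le_one h0.le h1 c1
          have d2 : D π ≤ 1 + D (f π) := by
            simp only [hD]
            exact_mod_cast c2
          rw [← mul_assoc]
          exact mul_le_mul d1 d2 (hD0 π) (mul_nonneg h0.le (hW0 _))
      _ = φ * ∑ π ∈ A.image f, W π * (1 + D π) := by rw [sum_image hfinj, mul_sum]
      _ ≤ _ := by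
          refine mul_le_mul_of_nonneg_left (sum_le_sum_of_subset_of_nonneg (subset_univ _)
            fun π _ _ => ?_) h0.le
          exact mul_nonneg (hW0 π) (by linarith [hD0 π])
  simp only [mul_add, mul_one, sum_add_distrib] at main
  have : φ * ∑ π, W π ≤ ∑ π, W π := mul_le_of_le_one_left (sum_nonneg fun π _ => hW0 π) h1
  linarith

theorem kendallTau_eq_card_discordant (π τ : Perm (Fin n)) : kendallTau π τ =
    #(discordant (fun z => ((τ.symm z : ℕ) : ℤ)) ((fun p : Fin n => ((p : ℕ) : ℤ)) ∘ π.symm)) := by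
  rw [kendallTau, discordant]
  refine card_equiv (Equiv.prodComm _ _) fun p => ?_
  simp [and_comm]

/-- Negating ranks and positions keeps the discordance count but makes `delayed` count the elements
that moved from behind `x` to before it. -/
theorem kendallTau_eq_card_discordant_neg (π τ : Perm (Fin n)) : kendallTau π τ =
    #(discordant (fun z => -((τ.symm z : ℕ) : ℤ))
      ((fun p : Fin n => -((p : ℕ) : ℤ)) ∘ π.symm)) := by
  rw [kendallTau, discordant]
  congr 1
  ext p
  simp [and_comm]

theorem abs_position_sub_le (π τ : Perm (Fin n)) (x : Fin n) :
    |((π.symm x : ℕ) : ℝ) - ((τ.symm x : ℕ) : ℝ)| ≤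
      (#(delayed (fun z => ((τ.symm z : ℕ) : ℤ))
        ((fun p : Fin n => ((p : ℕ) : ℤ)) ∘ π.symm) x) : ℝ) +
      #(delayed (fun z => -((τ.symm z : ℕ) : ℤ))
        ((fun p : Fin n => -((p : ℕ) : ℤ)) ∘ π.symm) x) := by
  have hcard : ∀ σ : Perm (Fin n), ((σ.symm x : Fin n) : ℕ) = #{z | σ.symm z < σ.symm x} := by
    intro σ
    rw [card_filter_comp σ.symm fun p => p < σ.symm x, ← Fin.card_Iio]
    congr 1
    ext p
    simp
  have a : ((π.symm x : Fin n) : ℕ) ≤ (τ.symm x : Fin n) +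
      #(delayed (fun z => -((τ.symm z : ℕ) : ℤ))
        ((fun p : Fin n => -((p : ℕ) : ℤ)) ∘ π.symm) x) := by
    rw [hcard π, hcard τ]
    refine le_trans (card_le_card ?_) (card_union_le _ _)
    intro z hz
    rw [mem_filter] at hz
    have hzx : z ≠ x := fun h => hz.2.ne (by rw [h])
    have := τ.symm.injective.ne hzx
    rw [mem_union, mem_filter, mem_delayed]
    simp only [Function.comp, neg_lt_neg_iff, Nat.cast_lt, Fin.val_fin_lt]
    rcases this.lt_or_gt with h | h
    · exact Or.inl ⟨mem_univ _, h⟩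
    · exact Or.inr ⟨h, hz.2⟩
  have b : ((τ.symm x : Fin n) : ℕ) ≤ (π.symm x : Fin n) +
      #(delayed (fun z => ((τ.symm z : ℕ) : ℤ))
        ((fun p : Fin n => ((p : ℕ) : ℤ)) ∘ π.symm) x) := by
    rw [hcard π, hcard τ]
    refine le_trans (card_le_card ?_) (card_union_le _ _)
    intro z hz
    rw [mem_filter] at hz
    have hzx : z ≠ x := fun h => hz.2.ne (by rw [h])
    have := π.symm.injective.ne hzx
    rw [mem_union, mem_filter, mem_delayed]
    simp only [Function.comp, Nat.cast_lt, Fin.val_fin_lt]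
    rcases this.lt_or_gt with h | h
    · exact Or.inl ⟨mem_univ _, h⟩
    · exact Or.inr ⟨hz.2, h⟩
  have a' : ((π.symm x : ℕ) : ℝ) ≤ ((τ.symm x : ℕ) : ℝ) +
      #(delayed (fun z => -((τ.symm z : ℕ) : ℤ))
        ((fun p : Fin n => -((p : ℕ) : ℤ)) ∘ π.symm) x) := by exact_mod_cast a
  have b' : ((τ.symm x : ℕ) : ℝ) ≤ ((π.symm x : ℕ) : ℝ) +
      #(delayed (fun z => ((τ.symm z : ℕ) : ℤ))
        ((fun p : Fin n => ((p : ℕ) : ℤ)) ∘ π.symm) x) := by exact_mod_cast b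
  rw [abs_le]
  constructor
  · linarith [Nat.cast_nonneg (α := ℝ) #(delayed (fun z => -((τ.symm z : ℕ) : ℤ))
        ((fun p : Fin n => -((p : ℕ) : ℤ)) ∘ π.symm) x)]
  · linarith [Nat.cast_nonneg (α := ℝ) #(delayed (fun z => ((τ.symm z : ℕ) : ℤ))
        ((fun p : Fin n => ((p : ℕ) : ℤ)) ∘ π.symm) x)]

/-- The mean distance of an element from its position in the base permutation. -/
theorem sum_pow_mul_abs_position_sub_le {φ : ℝ} (h0 : 0 < φ) (h1 : φ ≤ 1) (τ : Perm (Fin n))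
    (x : Fin n) : (1 - φ) * ∑ π : Perm (Fin n), φ ^ kendallTau π τ *
      |((π.symm x : ℕ) : ℝ) - ((τ.symm x : ℕ) : ℝ)| ≤ 2 * partitionFn φ τ := by
  have a := sum_pow_discordant_mul_delayed_le h0 h1 (r := fun z => ((τ.symm z : ℕ) : ℤ))
    (g := fun p : Fin n => ((p : ℕ) : ℤ)) (fun p q h => by simpa [Fin.val_inj] using h) x
  have b := sum_pow_discordant_mul_delayed_le h0 h1 (r := fun z => -((τ.symm z : ℕ) : ℤ))
    (g := fun p : Fin n => -((p : ℕ) : ℤ)) (fun p q h => by simpa [Fin.val_inj] using h) x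
  simp only [← kendallTau_eq_card_discordant] at a
  simp only [← kendallTau_eq_card_discordant_neg] at b
  have he : 0 ≤ 1 - φ := by linarith
  calc _ ≤ (1 - φ) * ∑ π : Perm (Fin n), φ ^ kendallTau π τ *
        ((#(delayed (fun z => ((τ.symm z : ℕ) : ℤ))
        ((fun p : Fin n => ((p : ℕ) : ℤ)) ∘ π.symm) x) : ℝ) +
      #(delayed (fun z => -((τ.symm z : ℕ) : ℤ))
        ((fun p : Fin n => -((p : ℕ) : ℤ)) ∘ π.symm) x)) := by
        gcongr with π
        exact abs_position_sub_le π τ x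
    _ ≤ _ := by
        simp only [mul_add, sum_add_distrib]
        unfold partitionFn
        linarith

/-- Two elements that are close in the base permutation are close with probability at least
one half. -/
theorem partitionFn_le_two_mul_sum_close {φ : ℝ} (h0 : 0 < φ) (h1 : φ ≤ 1) (τ : Perm (Fin n))
    {x y : Fin n} {h : ℕ} (hh : 9 ≤ (1 - φ) * h)
    (hxy : (1 - φ) * |((τ.symm x : ℕ) : ℝ) - ((τ.symm y : ℕ) : ℝ)| ≤ 1) :
    partitionFn φ τ ≤ 2 * ∑ π : Perm (Fin n), φ ^ kendallTau π τ *
      (if |((π.symm x : ℕ) : ℝ) - ((π.symm y : ℕ) : ℝ)| ≤ h then 1 else 0) := by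
  have a := sum_pow_mul_abs_position_sub_le h0 h1 τ x
  have b := sum_pow_mul_abs_position_sub_le h0 h1 τ y
  have he : 0 ≤ 1 - φ := by linarith
  -- Markov's inequality: a gap above h forces scaled deviations of total at least 9 - 1 = 8, while
  -- their mean is at most 2 + 2, so this has probability at most 1/2.
  have key : ∀ π : Perm (Fin n),
      (1 : ℝ) ≤ (if |((π.symm x : ℕ) : ℝ) - ((π.symm y : ℕ) : ℝ)| ≤ h then 1 else 0) +
      1 / 8 * ((1 - φ) * |((π.symm x : ℕ) : ℝ) - ((τ.symm x : ℕ) : ℝ)| +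
        (1 - φ) * |((π.symm y : ℕ) : ℝ) - ((τ.symm y : ℕ) : ℝ)|) := by
    intro π
    split_ifs with hc
    · have := mul_nonneg he (abs_nonneg (((π.symm x : ℕ) : ℝ) - ((τ.symm x : ℕ) : ℝ)))
      have := mul_nonneg he (abs_nonneg (((π.symm y : ℕ) : ℝ) - ((τ.symm y : ℕ) : ℝ)))
      linarith
    · have t : |((π.symm x : ℕ) : ℝ) - ((π.symm y : ℕ) : ℝ)| ≤
          |((π.symm x : ℕ) : ℝ) - ((τ.symm x : ℕ) : ℝ)| +
          |((τ.symm x : ℕ) : ℝ) - ((τ.symm y : ℕ) : ℝ)| +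
          |((π.symm y : ℕ) : ℝ) - ((τ.symm y : ℕ) : ℝ)| := by
        rw [abs_sub_comm ((π.symm y : ℕ) : ℝ) ((τ.symm y : ℕ) : ℝ)]
        refine le_trans (le_of_eq ?_) (abs_add_three _ _ _)
        congr 1
        ring
      have t' := mul_le_mul_of_nonneg_left t he
      have t2 := mul_le_mul_of_nonneg_left (not_le.1 hc).le he
      linarith
  have hsum : partitionFn φ τ ≤ ∑ π : Perm (Fin n), φ ^ kendallTau π τ *
      ((if |((π.symm x : ℕ) : ℝ) - ((π.symm y : ℕ) : ℝ)| ≤ h then 1 else 0) +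
      1 / 8 * ((1 - φ) * |((π.symm x : ℕ) : ℝ) - ((τ.symm x : ℕ) : ℝ)| +
        (1 - φ) * |((π.symm y : ℕ) : ℝ) - ((τ.symm y : ℕ) : ℝ)|)) := by
    unfold partitionFn
    refine sum_le_sum fun π _ => ?_
    exact le_mul_of_one_le_right (by positivity) (key π)
  have hsplit : ∑ π : Perm (Fin n), φ ^ kendallTau π τ *
      ((if |((π.symm x : ℕ) : ℝ) - ((π.symm y : ℕ) : ℝ)| ≤ h then 1 else 0) +
      1 / 8 * ((1 - φ) * |((π.symm x : ℕ) : ℝ) - ((τ.symm x : ℕ) : ℝ)| +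
        (1 - φ) * |((π.symm y : ℕ) : ℝ) - ((τ.symm y : ℕ) : ℝ)|)) =
      (∑ π : Perm (Fin n), φ ^ kendallTau π τ *
      (if |((π.symm x : ℕ) : ℝ) - ((π.symm y : ℕ) : ℝ)| ≤ h then 1 else 0)) +
      1 / 8 * ((1 - φ) * (∑ π : Perm (Fin n), φ ^ kendallTau π τ *
        |((π.symm x : ℕ) : ℝ) - ((τ.symm x : ℕ) : ℝ)|) +
        (1 - φ) * ∑ π : Perm (Fin n), φ ^ kendallTau π τ *
        |((π.symm y : ℕ) : ℝ) - ((τ.symm y : ℕ) : ℝ)|) := by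
    simp only [mul_sum, ← sum_add_distrib]
    exact sum_congr rfl fun π _ => by ring
  rw [hsplit] at hsum
  linarith

/-! ### The two grids of blocks -/

/-- The blocks of length `2 * h` shifted by `o`. -/
theorem exists_halfBlocks (n : ℕ) {h : ℕ} (hh : 0 < h) (o : ℕ) :
    ∃ B : HalfBlocks n, ∀ p, B.block p = (p + o) / (2 * h) := by
  set b : ℕ → ℕ := fun p => (p + o) / (2 * h) with hb
  -- Ends of block `k`; truncated subtraction clips the first block at 0, and `min` clips the last
  -- at `n`.
  set α : ℕ → ℕ := fun k => 2 * h * k - o with hα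
  set β : ℕ → ℕ := fun k => min n (2 * h * (k + 1) - o) with hβ
  have hbk : ∀ p k, p < n → (b p = k ↔ α k ≤ p ∧ p < β k) := by
    intro p k hp
    have : b p = k ↔ 2 * h * k ≤ p + o ∧ p + o < 2 * h * (k + 1) := by
      simp only [hb]
      rw [Nat.div_eq_iff (by omega)]
      have : 2 * h * (k + 1) = k * (2 * h) + 2 * h := by ring
      rw [this, mul_comm (2 * h) k]
      omega
    rw [this]
    simp only [hα, hβ]
    omega
  set t : ℕ → ℕ := fun k => (β k - α k) / 2 with ht
  -- Translate by half the length, rounded down; in a block of odd length the last position is fixed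
  -- and belongs to the right half.
  set m : ℕ → ℕ := fun p => if p < α (b p) + t (b p) then p + t (b p)
    else if p < α (b p) + 2 * t (b p) then p - t (b p) else p with hm
  have hmd : ∀ p, m p = if p < α (b p) + t (b p) then p + t (b p)
    else if p < α (b p) + 2 * t (b p) then p - t (b p) else p := fun p => rfl
  have hmain : ∀ p, p < n → m p < n ∧ b (m p) = b p := by
    intro p hp
    have h1 := (hbk p (b p) hp).1 rfl
    have h2 : β (b p) ≤ n := min_le_left _ _
    have h3 : α (b p) ≤ m p ∧ m p < β (b p) := by
      simp only [hm, ht]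
      split_ifs <;> omega
    exact ⟨by omega, (hbk _ _ (by omega)).2 h3⟩
  refine ⟨{
    block := fun p => b p
    left := univ.filter fun p : Fin n => (p : ℕ) < α (b p) + t (b p)
    mate := fun p => ⟨m p, (hmain p p.2).1⟩
    mate_mate := ?_
    block_mate := fun p => (hmain p p.2).2
    mate_notMem := ?_
    mate_mem := ?_
    eq_of_mate_eq := ?_
    half_monotone := ?_ }, fun p => rfl⟩
  · intro p
    apply Fin.ext
    have h1 := (hmain p p.2).2
    change m (m p) = p
    have h2 := (hbk p (b p) p.2).1 rfl
    rw [hmd (m p), h1, hmd p]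
    split_ifs <;> omega
  · intro p hp
    simp only [mem_filter, mem_univ, true_and] at hp ⊢
    have h2 := (hbk p (b p) p.2).1 rfl
    rw [(hmain p p.2).2, hmd p, if_pos hp]
    omega
  · intro p hp
    simp only [mem_filter, mem_univ, true_and] at hp ⊢
    have h2 := (hbk p (b p) p.2).1 rfl
    rw [Fin.ext_iff]
    change m p = p ∨ m p < α (b (m p)) + t (b (m p))
    rw [(hmain p p.2).2, hmd p, if_neg hp]
    split_ifs <;> omega
  · intro p q hp hq hpq
    have h1 := (hbk p (b p) p.2).1 rfl
    have h2 := (hbk q (b q) q.2).1 rfl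
    simp only [Fin.ext_iff, hm] at hp hq hpq ⊢
    change b p = b q at hpq
    rw [← hpq] at hq h2
    simp only [ht] at hp hq
    split_ifs at hp hq <;> omega
  · intro p q hpq
    have h1 : b p ≤ b q := Nat.div_le_div_right (by have : (p : ℕ) ≤ q := hpq; omega)
    simp only [mem_filter, mem_univ, true_and]
    rcases h1.lt_or_eq with h | h
    · split_ifs <;> omega
    · rw [h]
      have : (p : ℕ) ≤ q := hpq
      split_ifs <;> omega

theorem sameBlock_of_close {h p q : ℕ} (hpq : p ≤ q) (hqp : q ≤ p + h) :
    p / (2 * h) = q / (2 * h) ∨ (p + h) / (2 * h) = (q + h) / (2 * h) := by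
  rcases Nat.eq_zero_or_pos h with rfl | hh
  · simp
  have e := Nat.div_add_mod p (2 * h)
  have hr := Nat.mod_lt p (show 0 < 2 * h by omega)
  generalize p / (2 * h) = k at e
  generalize p % (2 * h) = r at e hr
  have key : ∀ a k, 2 * h * k ≤ a → a < 2 * h * k + 2 * h → a / (2 * h) = k := fun a k h1 h2 =>
    Nat.div_eq_of_lt_le (by rw [mul_comm]; exact h1) (by rw [add_mul, one_mul, mul_comm]; exact h2)
  have e' : 2 * h * (k + 1) = 2 * h * k + 2 * h := by ring
  rcases lt_or_ge r h with hlt | hge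
  · left
    exact (key q k (by omega) (by omega)).symm
  · right
    exact (key (p + h) (k + 1) (by omega) (by omega)).trans
      (key (q + h) (k + 1) (by omega) (by omega)).symm

theorem HalfBlocks.localRank_le_of_block {B : HalfBlocks n} {h o : ℕ} (hh : 0 < h)
    (hB : ∀ p, B.block p = (p + o) / (2 * h)) (ω : Perm (Fin n)) (p : Fin n) :
    B.localRank ω p ≤ 2 * h := by
  unfold localRank
  have : ∀ q : Fin n, q ∈ ({q | B.block q = B.block p ∧ ω q < ω p} : Finset (Fin n)) →
      (q : ℕ) + o ∈ Finset.Ico (2 * h * B.block p) (2 * h * B.block p + 2 * h) := by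
    intro q hq
    rw [mem_filter, hB q] at hq
    rw [← hq.2.1, Finset.mem_Ico]
    have := Nat.div_add_mod ((q : ℕ) + o) (2 * h)
    have := Nat.mod_lt ((q : ℕ) + o) (show 0 < 2 * h by omega)
    omega
  refine (card_le_card_of_injOn (fun q : Fin n => (q : ℕ) + o) this ?_).trans_eq ?_
  · intro q _ q' _ he
    exact Fin.ext (Nat.add_right_cancel he)
  · simp

/-! ### Assembling the bound -/

theorem sum_shift_sq_mul (α β π : Perm (Fin n)) :
    ∑ p, shift (α * π) (β * π) p ^ 2 = ∑ p, shift α β p ^ 2 :=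
  Equiv.sum_comp π fun p => shift α β p ^ 2

theorem partitionFn_eq (φ : ℝ) (τ : Perm (Fin n)) :
    partitionFn φ τ = ∑ π : Perm (Fin n), φ ^ invCount π := by
  unfold partitionFn
  simp only [kendallTau_eq_invCount]
  exact Equiv.sum_comp (Equiv.mulLeft τ⁻¹) fun π => φ ^ invCount π

theorem card_classPerms_mul_sum {H : Fin n → ℕ} (f : Perm (Fin n) → ℝ) :
    (#(classPerms H) : ℝ) * ∑ π, f π = ∑ π, ∑ g ∈ classPerms H, f (π * g) := by
  rw [sum_comm, ← nsmul_eq_mul, ← sum_const]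
  exact sum_congr rfl fun g _ => (Equiv.sum_comp (Equiv.mulRight g) f).symm

/-- Transfers averages of functions that ignore the order inside classes from the coarse weight to
the full one. -/
theorem sum_pow_crossCount_mul {H : Fin n → ℕ} (hH : Monotone H) (φ : ℝ) (α : Perm (Fin n))
    {F : Perm (Fin n) → ℝ} (hF : ∀ g ∈ classPerms H, ∀ π, F (π * g) = F π) :
    (∑ g ∈ classPerms H, φ ^ innerCount H g) * ∑ π, φ ^ crossCount H (α * π) * F π =
      #(classPerms H) * ∑ π, φ ^ invCount (α * π) * F π := by
  rw [card_classPerms_mul_sum, mul_sum]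
  refine sum_congr rfl fun π _ => ?_
  rw [← mul_assoc, ← sum_classPerms_pow_invCount hH, sum_mul]
  exact sum_congr rfl fun g hg => by rw [hF g hg, mul_assoc]

/-- Data processing: the triangle inequality on each coset of the class permutations. -/
theorem sum_abs_pow_crossCount_sub_le {H : Fin n → ℕ} (hH : Monotone H) {φ : ℝ} (h0 : 0 < φ)
    (α β : Perm (Fin n)) :
    (∑ g ∈ classPerms H, φ ^ innerCount H g) *
      ∑ π, |φ ^ crossCount H (α * π) - φ ^ crossCount H (β * π)| ≤
      #(classPerms H) * ∑ π, |φ ^ invCount (α * π) - φ ^ invCount (β * π)| := by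
  rw [card_classPerms_mul_sum, mul_sum]
  refine sum_le_sum fun π _ => ?_
  have hK : 0 ≤ ∑ g ∈ classPerms H, φ ^ innerCount H g := sum_nonneg fun g _ => by positivity
  conv_lhs => rw [← abs_of_nonneg hK, ← abs_mul]
  rw [mul_sub, ← sum_classPerms_pow_invCount hH, ← sum_classPerms_pow_invCount hH, ← sum_sub_distrib]
  refine (abs_sum_le_sum_abs _ _).trans_eq ?_
  simp only [mul_assoc]

/-- The weights of two base permutations differ by the average displacement within the blocks. -/
theorem sum_abs_pow_invCount_sub_ge {κ : ℝ} (hκ : 0 < κ) : ∃ c : ℝ, 0 < c ∧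
    ∀ {n : ℕ} (B : HalfBlocks n) {φ : ℝ} {ℓ : ℕ}, 0 < φ → φ ≤ 1 → κ ≤ φ ^ (2 * ℓ) →
      (∀ ω p, B.localRank ω p ≤ ℓ) → ∀ α β : Perm (Fin n),
      (1 - φ) ^ 2 * ∑ x, shift α β x ^ 2 ≤ 1 →
      c * ((1 - φ) * ∑ π, φ ^ invCount (α * π) * B.localNorm (α * π) (β * π)) ≤
        ∑ π, |φ ^ invCount (α * π) - φ ^ invCount (β * π)| := by
  obtain ⟨c, hc, H⟩ := HalfBlocks.sum_abs_pow_crossCount_sub_ge hκ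
  refine ⟨c * (κ ^ 2 / 4), by positivity, ?_⟩
  intro n B φ ℓ h0 h1 hκφ hℓ α β hD
  have he : 0 ≤ 1 - φ := by linarith
  have hr : ∀ ω p, κ ≤ φ ^ B.localRank ω p := fun ω p =>
    hκφ.trans (pow_le_pow_of_le_one h0.le h1 (by have := hℓ ω p; omega))
  have hu : ∀ π, (1 - φ) ^ 2 * ∑ p, B.localShift (α * π) (β * π) p ^ 2 ≤ 1 := fun π => by
    refine (mul_le_mul_of_nonneg_left ?_ (sq_nonneg _)).trans hD
    rw [← sum_shift_sq_mul α β π]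
    exact B.sum_localShift_sq_le _ _
  have m1 := H B h0 h1 hr α β hu
  have m2 := B.sum_mul_localNorm_le h0 h1 hℓ α β
  have hmono : Monotone B.half := B.half_monotone
  set K := ∑ g ∈ classPerms B.half, φ ^ innerCount B.half g with hK
  have hK0 : 0 ≤ K := sum_nonneg fun g _ => by positivity
  have m3 := sum_abs_pow_crossCount_sub_le hmono h0 α β
  have m4 := sum_pow_crossCount_mul hmono φ α (F := fun π => B.localNorm (α * π) (β * π))
    (fun g hg π => by
      rw [← mul_assoc, ← mul_assoc]
      exact B.localNorm_mul (fun p => B.block_eq_of_half_eq (mem_classPerms.1 hg p)) _ _)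
  rw [← hK] at m3 m4
  have hG : (0 : ℝ) < #(classPerms B.half) := by
    exact_mod_cast card_pos.2 ⟨1, one_mem_classPerms _⟩
  refine le_of_mul_le_mul_left ?_ hG
  set X := ∑ π, φ ^ crossCount B.half (α * π) * B.localNorm (α * π) (β * π)
  have hX : 0 ≤ X := sum_nonneg fun π _ => mul_nonneg (by positivity) (Real.sqrt_nonneg _)
  calc #(classPerms B.half) * (c * (κ ^ 2 / 4) * ((1 - φ) *
        ∑ π, φ ^ invCount (α * π) * B.localNorm (α * π) (β * π)))
      = K * (c * ((1 - φ) * (κ ^ 2 / 4 * X))) := by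
        linear_combination (-(c * (κ ^ 2 / 4) * (1 - φ))) * m4
    _ ≤ K * (c * ((1 - φ) * ((φ ^ (2 * ℓ)) ^ 2 / 4 * X))) := by gcongr
    _ ≤ K * (c * ((1 - φ) *
          ∑ π, φ ^ crossCount B.half (α * π) * B.mateShift (α * π) (β * π))) := by gcongr
    _ ≤ K * ∑ π, |φ ^ crossCount B.half (α * π) - φ ^ crossCount B.half (β * π)| := by gcongr
    _ ≤ _ := m3

theorem sum_sameBlock_mul_le {κ : ℝ} (hκ : 0 < κ) : ∃ c : ℝ, 0 < c ∧
    ∀ {n : ℕ} (B : HalfBlocks n) {φ : ℝ} {ℓ : ℕ}, 0 < φ → φ ≤ 1 → κ ≤ φ ^ (2 * ℓ) →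
      (∀ ω p, B.localRank ω p ≤ ℓ) → ∀ α β : Perm (Fin n),
      (1 - φ) ^ 2 * ∑ x, shift α β x ^ 2 ≤ 1 →
      c * ((1 - φ) * ∑ x, ∑ y, (shift α β x - shift α β y) * orderShift α β x y *
        ∑ π : Perm (Fin n), φ ^ invCount (α * π) *
          (if B.block (π.symm y) = B.block (π.symm x) then 1 else 0)) ≤
        √(∑ x, shift α β x ^ 2) * ∑ π, |φ ^ invCount (α * π) - φ ^ invCount (β * π)| := by
  obtain ⟨c, hc, H⟩ := sum_abs_pow_invCount_sub_ge hκ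
  refine ⟨c / 2, by positivity, ?_⟩
  intro n B φ ℓ h0 h1 hκφ hℓ α β hD
  have he : 0 ≤ 1 - φ := by linarith
  have hm := H B h0 h1 hκφ hℓ α β hD
  have e : ∑ x, ∑ y, (shift α β x - shift α β y) * orderShift α β x y *
        ∑ π : Perm (Fin n), φ ^ invCount (α * π) *
          (if B.block (π.symm y) = B.block (π.symm x) then 1 else 0) =
      ∑ π : Perm (Fin n), φ ^ invCount (α * π) * ∑ p, ∑ q,
        (if B.block q = B.block p then (shift (α * π) (β * π) p - shift (α * π) (β * π) q) *
          orderShift (α * π) (β * π) p q else 0) := by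
    have e1 : ∀ π : Perm (Fin n), ∑ p, ∑ q,
        (if B.block q = B.block p then (shift (α * π) (β * π) p - shift (α * π) (β * π) q) *
          orderShift (α * π) (β * π) p q else 0) =
        ∑ x, ∑ y, (shift α β x - shift α β y) * orderShift α β x y *
          (if B.block (π.symm y) = B.block (π.symm x) then 1 else 0) := by
      intro π
      symm
      rw [← Equiv.sum_comp π]
      refine sum_congr rfl fun p _ => ?_
      rw [← Equiv.sum_comp π]
      refine sum_congr rfl fun q _ => ?_
      rw [symm_apply_apply, symm_apply_apply, mul_ite, mul_one, mul_zero]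
      rfl
    simp only [e1, mul_sum]
    refine ((sum_congr rfl fun x _ => sum_comm).trans sum_comm).trans ?_
    refine sum_congr rfl fun π _ => ?_
    refine sum_congr rfl fun x _ => sum_congr rfl fun y _ => ?_
    ring
  rw [e]
  have hle : ∑ π : Perm (Fin n), φ ^ invCount (α * π) * ∑ p, ∑ q,
        (if B.block q = B.block p then (shift (α * π) (β * π) p - shift (α * π) (β * π) q) *
          orderShift (α * π) (β * π) p q else 0) ≤ 2 * (√(∑ x, shift α β x ^ 2) *
        ∑ π, φ ^ invCount (α * π) * B.localNorm (α * π) (β * π)) := by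
    rw [mul_sum, mul_sum]
    refine sum_le_sum fun π _ => ?_
    have := B.sum_sameBlock_le (α * π) (β * π)
    rw [sum_shift_sq_mul] at this
    have hp : 0 ≤ φ ^ invCount (α * π) := by positivity
    nlinarith [mul_le_mul_of_nonneg_left this hp]
  calc _ ≤ c / 2 * ((1 - φ) * (2 * (√(∑ x, shift α β x ^ 2) *
        ∑ π, φ ^ invCount (α * π) * B.localNorm (α * π) (β * π)))) := by gcongr
    _ = √(∑ x, shift α β x ^ 2) * (c * ((1 - φ) *
        ∑ π, φ ^ invCount (α * π) * B.localNorm (α * π) (β * π))) := by ring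
    _ ≤ _ := by gcongr

theorem abs_shift_le_sqrt (α β : Perm (Fin n)) (x : Fin n) :
    |shift α β x| ≤ √(∑ x, shift α β x ^ 2) := by
  refine Real.le_sqrt_of_sq_le ?_
  rw [sq_abs]
  exact single_le_sum (f := fun x => shift α β x ^ 2) (fun x _ => sq_nonneg _) (mem_univ x)

/-- Two elements that change order must cover their gap by their own displacements, each at most the
norm. -/
theorem abs_sub_le_of_orderShift_ne_zero {α β : Perm (Fin n)} {x y : Fin n}
    (h : orderShift α β x y ≠ 0) :
    |((α x : ℕ) : ℝ) - ((α y : ℕ) : ℝ)| ≤ 2 * √(∑ x, shift α β x ^ 2) := by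
  have hx := abs_shift_le_sqrt α β x
  have hy := abs_shift_le_sqrt α β y
  rw [abs_le] at hx hy ⊢
  unfold orderShift at h
  have cast : ∀ a b : Fin n, a < b → ((a : ℕ) : ℝ) < ((b : ℕ) : ℝ) := fun a b h => by
    exact_mod_cast h
  have cast' : ∀ a b : Fin n, ¬ a < b → ((b : ℕ) : ℝ) ≤ ((a : ℕ) : ℝ) := fun a b h => by
    exact_mod_cast not_lt.1 h
  set D := √(∑ x, shift α β x ^ 2)
  simp only [shift] at hx hy
  split_ifs at h with h1 h2 h2
  · simp at h
  · have := cast _ _ h1; have := cast' _ _ h2; constructor <;> linarith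
  · have := cast' _ _ h1; have := cast _ _ h2; constructor <;> linarith
  · simp at h

theorem norm_positionVector_sub (πs σs : Perm (Fin n)) :
    ‖positionVector πs - positionVector σs‖ = √(∑ x, shift πs⁻¹ σs⁻¹ x ^ 2) := by
  rw [EuclideanSpace.norm_eq]
  congr 1
  refine sum_congr rfl fun x _ => ?_
  simp only [positionVector, PiLp.sub_apply, Real.norm_eq_abs, sq_abs, shift, Perm.inv_def]
  ring

theorem tvDist_model {φ : ℝ} (hφ : 0 ≤ φ) (πs σs : Perm (Fin n)) :
    tvDist (model φ hφ πs) (model φ hφ σs) =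
      (∑ π, |φ ^ invCount (πs⁻¹ * π) - φ ^ invCount (σs⁻¹ * π)|) / (2 * partitionFn φ πs) := by
  have hW := partitionFn_pos hφ πs
  have e : partitionFn φ σs = partitionFn φ πs := by rw [partitionFn_eq, partitionFn_eq]
  have key : ∀ τ π : Perm (Fin n), (model φ hφ τ π).toReal =
      φ ^ invCount (τ⁻¹ * π) / partitionFn φ τ := fun τ π => by
    rw [model, PMF.ofFintype_apply, ENNReal.toReal_ofReal (mass_nonneg hφ _ _), mass,
      kendallTau_eq_invCount]
  unfold tvDist
  simp only [key, e, ← sub_div, abs_div, abs_of_pos hW]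
  rw [← sum_div]
  ring

theorem tvDist_nonneg {α : Type*} [Fintype α] (p q : PMF α) : 0 ≤ tvDist p q :=
  mul_nonneg (by norm_num) (sum_nonneg fun _ _ => abs_nonneg _)

/-- The lower bound for the total variation distance of two Mallows models. -/
theorem exists_le_tvDist_model : ∃ c : ℝ, 0 < c ∧ ∀ {n : ℕ} {φ : ℝ} (hφ : 0 ≤ φ), φ ≤ 1 →
    ∀ πs σs : Perm (Fin n), 2 * (1 - φ) * ‖positionVector πs - positionVector σs‖ ≤ 1 →
      c * ((1 - φ) * ‖positionVector πs - positionVector σs‖) ≤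
        tvDist (model φ hφ πs) (model φ hφ σs) := by
  obtain ⟨c, hc, H⟩ := sum_sameBlock_mul_le (Real.exp_pos (-80))
  refine ⟨c / 4, by positivity, ?_⟩
  intro n φ hφ h1 πs σs hD
  rw [norm_positionVector_sub] at hD ⊢
  set α := πs⁻¹ with hα
  set β := σs⁻¹ with hβ
  set V := ∑ x, shift α β x ^ 2 with hV
  have hV0 : 0 ≤ V := sum_nonneg fun _ _ => sq_nonneg _
  rcases h1.lt_or_eq with hlt | rfl
  swap
  · rw [sub_self, zero_mul, mul_zero]
    exact tvDist_nonneg _ _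
  rcases hV0.eq_or_lt with hV00 | hVpos
  · rw [← hV00, Real.sqrt_zero, mul_zero, mul_zero]
    exact tvDist_nonneg _ _
  have he : 0 < 1 - φ := by linarith
  -- `V` is a positive integer, so D ≥ 1 and the hypothesis forces φ ≥ 1/2.
  have hV1 : 1 ≤ V := by
    obtain ⟨m, hm⟩ : ∃ m : ℤ, V = m :=
      ⟨∑ x, (((β x : ℕ) : ℤ) - ((α x : ℕ) : ℤ)) ^ 2, by rw [hV]; push_cast; rfl⟩
    rw [hm] at hVpos ⊢
    have : 0 < m := by exact_mod_cast hVpos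
    exact_mod_cast this
  set D := √V with hDdef
  have hD1 : 1 ≤ D := Real.one_le_sqrt.2 hV1
  have hDD : D * D = V := Real.mul_self_sqrt hV0
  have he2 : 1 - φ ≤ 1 / 2 := by nlinarith
  have h0 : 0 < φ := by linarith
  have hεV : (1 - φ) ^ 2 * V ≤ 1 := by
    have : 0 ≤ (1 - φ) * D := by positivity
    rw [← hDD]
    nlinarith
  set h := ⌈9 / (1 - φ)⌉₊ with hh
  have hh9 : 9 ≤ (1 - φ) * h := by
    have := Nat.le_ceil (9 / (1 - φ))
    rw [div_le_iff₀ he] at this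
    linarith
  have hh10 : (1 - φ) * h ≤ 10 := by
    have := Nat.ceil_lt_add_one (show 0 ≤ 9 / (1 - φ) by positivity)
    rw [← hh, ← sub_lt_iff_lt_add, lt_div_iff₀ he] at this
    linarith
  have hhpos : 0 < h := by
    rw [Nat.pos_iff_ne_zero]
    intro h'
    rw [h'] at hh9
    norm_num at hh9
  -- Local ranks are at most 2h, so the exponent needed is 4h. As φ ≥ exp(-2(1-φ)) for φ ≥ 1/2, the
  -- power is at least exp(-8h(1-φ)), with h(1-φ) ≤ 10.
  have hκ : Real.exp (-80) ≤ φ ^ (2 * (2 * h)) := by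
    have a : Real.exp (-(2 * (1 - φ))) ≤ φ := by
      have := Real.add_one_le_exp (2 * (1 - φ))
      rw [Real.exp_neg]
      refine inv_le_of_inv_le₀ h0 (le_trans ?_ this)
      rw [inv_le_iff_one_le_mul₀ h0]
      nlinarith
    calc Real.exp (-80) ≤ Real.exp ((2 * (2 * h) : ℕ) * (-(2 * (1 - φ)))) := by
          rw [Real.exp_le_exp]
          push_cast
          linarith
      _ = Real.exp (-(2 * (1 - φ))) ^ (2 * (2 * h)) := by rw [Real.exp_nat_mul]
      _ ≤ _ := by gcongr
  set X := ∑ π, |φ ^ invCount (α * π) - φ ^ invCount (β * π)| with hX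
  set t : Fin n → Fin n → ℝ := fun x y => (shift α β x - shift α β y) * orderShift α β x y with ht
  have ht0 : ∀ x y, 0 ≤ t x y := fun x y => shift_sub_mul_orderShift_nonneg _ _ _ _
  have htsum : ∑ x, ∑ y, t x y = 2 * V := by
    rw [hV, sum_shift_sq]
    ring
  obtain ⟨B₀, hB₀⟩ := exists_halfBlocks n hhpos 0
  obtain ⟨B₁, hB₁⟩ := exists_halfBlocks n hhpos h
  have m₀ := H B₀ h0 h1 hκ (HalfBlocks.localRank_le_of_block hhpos hB₀) α β hεV
  have m₁ := H B₁ h0 h1 hκ (HalfBlocks.localRank_le_of_block hhpos hB₁) α β hεV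
  have hW := partitionFn_pos hφ πs
  have hkt : ∀ π, kendallTau π πs = invCount (α * π) := fun π => kendallTau_eq_invCount _ _
  -- Only pairs that change order contribute; such a pair shares a block in one of the two grids
  -- with probability at least 1/2.
  have hpair : ∀ x y, t x y * partitionFn φ πs ≤
      2 * (t x y * ∑ π : Perm (Fin n), φ ^ invCount (α * π) *
          (if B₀.block (π.symm y) = B₀.block (π.symm x) then 1 else 0) +
        t x y * ∑ π : Perm (Fin n), φ ^ invCount (α * π) *
          (if B₁.block (π.symm y) = B₁.block (π.symm x) then 1 else 0)) := by
    intro x y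
    rcases eq_or_ne (orderShift α β x y) 0 with h' | h'
    · simp [ht, h']
    have hxy : (1 - φ) * |((α x : ℕ) : ℝ) - ((α y : ℕ) : ℝ)| ≤ 1 := by
      refine le_trans (mul_le_mul_of_nonneg_left (abs_sub_le_of_orderShift_ne_zero h') he.le) ?_
      rw [← hV, ← hDdef]
      linarith
    have hcl := partitionFn_le_two_mul_sum_close h0 h1 πs (x := x) (y := y) hh9 hxy
    rw [← mul_add, ← sum_add_distrib, mul_left_comm]
    refine mul_le_mul_of_nonneg_left (hcl.trans ?_) (ht0 x y)
    gcongr with π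
    rw [hkt, ← mul_add]
    gcongr
    by_cases hc : |((π.symm x : ℕ) : ℝ) - ((π.symm y : ℕ) : ℝ)| ≤ h
    · rw [if_pos hc]
      have hs : B₀.block (π.symm y) = B₀.block (π.symm x) ∨
          B₁.block (π.symm y) = B₁.block (π.symm x) := by
        rw [hB₀, hB₀, hB₁, hB₁]
        rw [abs_le] at hc
        have c1 : ((π.symm x : Fin n) : ℕ) ≤ (π.symm y : Fin n) + h := by
          have : ((π.symm x : ℕ) : ℝ) ≤ ((π.symm y : ℕ) : ℝ) + h := by linarith
          exact_mod_cast this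
        have c2 : ((π.symm y : Fin n) : ℕ) ≤ (π.symm x : Fin n) + h := by
          have : ((π.symm y : ℕ) : ℝ) ≤ ((π.symm x : ℕ) : ℝ) + h := by linarith
          exact_mod_cast this
        rcases le_total ((π.symm x : Fin n) : ℕ) (π.symm y : Fin n) with h' | h'
        · exact (sameBlock_of_close h' c2).imp Eq.symm Eq.symm
        · exact sameBlock_of_close h' c1
      rcases hs with hs | hs
      · rw [if_pos hs]; split_ifs <;> norm_num
      · rw [if_pos hs]; split_ifs <;> norm_num
    · rw [if_neg hc]
      split_ifs <;> norm_num
  have hall : V * partitionFn φ πs ≤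
      (∑ x, ∑ y, t x y * ∑ π : Perm (Fin n), φ ^ invCount (α * π) *
          (if B₀.block (π.symm y) = B₀.block (π.symm x) then 1 else 0)) +
        ∑ x, ∑ y, t x y * ∑ π : Perm (Fin n), φ ^ invCount (α * π) *
          (if B₁.block (π.symm y) = B₁.block (π.symm x) then 1 else 0) := by
    have := sum_le_sum fun x (_ : x ∈ univ) => sum_le_sum fun y (_ : y ∈ univ) => hpair x y
    simp only [← sum_mul, ← mul_sum, sum_add_distrib, htsum] at this
    linarith
  have hfin : c * ((1 - φ) * (V * partitionFn φ πs)) ≤ 2 * (D * X) := by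
    have := mul_le_mul_of_nonneg_left (mul_le_mul_of_nonneg_left hall he.le) hc.le
    refine this.trans ?_
    rw [mul_add, mul_add]
    linarith
  rw [tvDist_model, le_div_iff₀ (by positivity)]
  have hD0 : 0 < D := by linarith
  -- The bound `hfin` has D² on the left and D on the right; one factor D cancels.
  refine le_of_mul_le_mul_left ?_ hD0
  rw [← hDD] at hfin
  change _ ≤ D * X
  linarith

end Mallows

theorem theorem4p2 :
    ∃ C : ℝ, 0 < C ∧
      ∀ (n : ℕ) (φ : ℝ) (hφ : 0 ≤ φ) (_ : φ ≤ 1) (πs σs : Equiv.Perm (Fin n)),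
        2 * (1 - φ) * ‖Mallows.positionVector πs - Mallows.positionVector σs‖ ≤ 1 →
        (1 - φ) * ‖Mallows.positionVector πs - Mallows.positionVector σs‖ / C ≤
          Mallows.tvDist (Mallows.model φ hφ πs) (Mallows.model φ hφ σs) := by
  obtain ⟨c, hc, H⟩ := Mallows.exists_le_tvDist_model
  refine ⟨c⁻¹, inv_pos.2 hc, fun n φ hφ h1 πs σs h => ?_⟩
  rw [div_inv_eq_mul, mul_comm]
  exact H hφ h1 πs σs h
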